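/- Let $k$ be a commutative ring, $R$ a $k$-algebra, $A$ an $R$-ring (a $k$-algebra with multiplication $\mu_A$ and a $k$-algebra map $\eta_A:R\to A$) and $C$ an $R$-coring with coproduct $\Delta_C$ and counit $\varepsilon_C$. Let $(A,C,\psi)_R$ be a bijective right entwining structure, i.e. $\psi:C\otimes_R A\to A\otimes_R C$ is a bijective $R$-$R$ bimodule map with $$\psi(C\otimes_R\mu_A)=(\mu_A\otimes_R C)(A\otimes_R\psi)(\psi\otimes_R A),\qquad \psi(C\otimes_R\eta_A)=\eta_A\otimes_R C,$$ $$(A\otimes_R\Delta_C)\psi=(\psi\otimes_R C)(C\otimes_R\psi)(\Delta_C\otimes_R A),\qquad (A\otimes_R\varepsilon_C)\psi=\varepsilon_C\otimes_R A.$$ Let $\varrho:A\to A\otimes_R C$ be a right $C$-coaction making $A$, with its right regular action, a right entwined module, i.e. $\varrho\circ\mu_A=(\mu_A\otimes_R C)(A\otimes_R\psi)(\varrho\otimes_R A)$. Let $B=\{b\in A: \varrho(b)=b\varrho(1_A)\}$ be the $k$-subalgebra of coinvariants (so $B\subseteq A$ is an entwined extension), and let $T$ be a $k$-subalgebra of $B$.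 A strong $T$-connection is an $R$-$R$ bimodule map $\ell:C\to A\otimes_T A$ which is right $C$-colinear for the coaction $A\otimes_T\varrho$ and left $C$-colinear for the coaction ${}^A\!\varrho\otimes_T A$, where ${}^A\!\varrho(a)=\psi^{-1}(a\varrho(1_A))$, and which satisfies $\widetilde{\mathrm{can}}_T(\ell(c))=1_A\otimes_R c$ for all $c\in C$, where $\widetilde{\mathrm{can}}_T(a\otimes_T a')=a\varrho(a')$. Suppose that $A$ is a projective right $T$-module, a flat left $T$-module and a faithfully flat right $B$-module, and that a strong $T$-connection exists. Then for every left $C$-comodule $W$ (with coaction ${}^W\!\varrho:W\to C\otimes_R W$) that is finitely generated as a left $R$-module, the cotensor product $$\Gamma=A\,\square_C W=\{x\in A\otimes_R W:\ (\varrho\otimes_R W)(x)=(A\otimes_R{}^W\!\varrho)(x)\},$$ with the left $B$-action $b(a\otimes_R w)=ba\otimes_R w$, is a finitely generated left $B$-module and is $T$-relative projective, i.e. the multiplication map $B\otimes_T\Gamma\to\Gamma$ has a left $B$-linear section. -/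

import Mathlib

open MulOpposite
open scoped TensorProduct

universe u v w

noncomputable section

/-!
Tensor products over a noncommutative ring. Right modules over a ring `S` are modules over `Sᵐᵒᵖ`;
an `S`-`Q` bimodule carries commuting structures `Module S M` and `Module Qᵐᵒᵖ M`.
-/

/-- The tensor product `M ⊗_S N` of a right `S`-module `M` and a left `S`-module `N` over a (not
necessarily commutative) ring `S`: the quotient of the tensor product of abelian groups by the
relations `m s ⊗ n = m ⊗ s n`. -/
def BTensor (S : Type u) (M : Type v) (N : Type w) [Ring S] [AddCommGroup M] [Module Sᵐᵒᵖ M]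
    [AddCommGroup N] [Module S N] : Type (max v w) :=
  (M ⊗[ℤ] N) ⧸ Submodule.span ℤ
    {z : M ⊗[ℤ] N | ∃ (m : M) (s : S) (n : N), z = (op s • m) ⊗ₜ[ℤ] n - m ⊗ₜ[ℤ] (s • n)}

notation:100 M:100 " ⊠[" S "] " N:101 => BTensor S M N

namespace BTensor

section Basic

variable {S : Type*} [Ring S] {M M' M'' N N' P : Type*}
  [AddCommGroup M] [Module Sᵐᵒᵖ M] [AddCommGroup M'] [Module Sᵐᵒᵖ M']
  [AddCommGroup N] [Module S N] [AddCommGroup N'] [Module S N'] [AddCommGroup P]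

instance : AddCommGroup (M ⊠[S] N) :=
  inferInstanceAs (AddCommGroup ((M ⊗[ℤ] N) ⧸ Submodule.span ℤ
    {z : M ⊗[ℤ] N | ∃ (m : M) (s : S) (n : N), z = (op s • m) ⊗ₜ[ℤ] n - m ⊗ₜ[ℤ] (s • n)}))

variable (S) in
/-- The pure tensor `m ⊗ n` in `M ⊗_S N`. -/
def tmul (m : M) (n : N) : M ⊠[S] N := Submodule.Quotient.mk (m ⊗ₜ[ℤ] n)

theorem tmul_add (m : M) (n n' : N) : tmul S m (n + n') = tmul S m n + tmul S m n' :=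
  congrArg Submodule.Quotient.mk (TensorProduct.tmul_add m n n')

theorem add_tmul (m m' : M) (n : N) : tmul S (m + m') n = tmul S m n + tmul S m' n :=
  congrArg Submodule.Quotient.mk (TensorProduct.add_tmul m m' n)

theorem smul_tmul (m : M) (s : S) (n : N) : tmul S (op s • m) n = tmul S m (s • n) :=
  (Submodule.Quotient.eq _).2 (Submodule.subset_span ⟨m, s, n, rfl⟩)

variable (S M N) in
/-- The biadditive map `(m, n) ↦ m ⊗ n`. -/
def mk : M →+ N →+ M ⊠[S] N :=
  AddMonoidHom.mk' (fun m => AddMonoidHom.mk' (fun n => tmul S m n) (tmul_add m))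
    (fun m m' => AddMonoidHom.ext fun n => add_tmul m m' n)

@[simp] theorem mk_apply (m : M) (n : N) : mk S M N m n = tmul S m n := rfl

@[simp] theorem zero_tmul (n : N) : tmul S (0 : M) n = 0 :=
  DFunLike.congr_fun (mk S M N).map_zero n

@[simp] theorem tmul_zero (m : M) : tmul S m (0 : N) = 0 := (mk S M N m).map_zero

@[elab_as_elim]
theorem induction {p : M ⊠[S] N → Prop} (z : M ⊠[S] N) (zero : p 0)
    (tmul : ∀ m n, p (tmul S m n)) (add : ∀ x y, p x → p y → p (x + y)) : p z := by
  obtain ⟨z, rfl⟩ := Submodule.Quotient.mk_surjective _ z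
  induction z with
  | zero => exact zero
  | tmul m n => exact tmul m n
  | add x y hx hy => exact add _ _ hx hy

/-- The universal property: a biadditive `S`-balanced map factors through `M ⊗_S N`. -/
def lift (f : M →+ N →+ P) (hf : ∀ (m : M) (s : S) (n : N), f (op s • m) n = f m (s • n)) :
    M ⊠[S] N →+ P :=
  (Submodule.liftQ _
    (TensorProduct.liftAddHom f (fun r m n => by simp)).toIntLinearMap
    (by
      rw [Submodule.span_le]
      rintro _ ⟨m, s, n, rfl⟩
      simp [hf])).toAddMonoidHom

@[simp] theorem lift_tmul (f : M →+ N →+ P)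
    (hf : ∀ (m : M) (s : S) (n : N), f (op s • m) n = f m (s • n)) (m : M) (n : N) :
    lift f hf (tmul S m n) = f m n := rfl

theorem hom_ext {f g : M ⊠[S] N →+ P} (h : ∀ m n, f (tmul S m n) = g (tmul S m n)) : f = g := by
  ext z
  induction z using induction with
  | zero => simp
  | tmul m n => exact h m n
  | add x y hx hy => simp [hx, hy]

/-- The tensor product `f ⊗_S g` of a right `S`-linear map and a left `S`-linear map. -/
def map (f : M →ₗ[Sᵐᵒᵖ] M') (g : N →ₗ[S] N') : M ⊠[S] N →+ M' ⊠[S] N' :=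
  lift (((mk S M' N').comp f.toAddMonoidHom).compl₂ g.toAddMonoidHom)
    (fun m s n => by simp [smul_tmul])

@[simp] theorem map_tmul (f : M →ₗ[Sᵐᵒᵖ] M') (g : N →ₗ[S] N') (m : M) (n : N) :
    map f g (tmul S m n) = tmul S (f m) (g n) := rfl

theorem map_id : map (LinearMap.id : M →ₗ[Sᵐᵒᵖ] M) (LinearMap.id : N →ₗ[S] N)
    = AddMonoidHom.id _ := hom_ext fun _ _ => rfl

end Basic

section Actions

variable {S : Type*} [Ring S] {M N : Type*}
  [AddCommGroup M] [Module Sᵐᵒᵖ M] [AddCommGroup N] [Module S N]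
  {L : Type*} [Ring L] [Module L M] [SMulCommClass L Sᵐᵒᵖ M]
  {Q : Type*} [Ring Q] [Module Qᵐᵒᵖ N] [SMulCommClass S Qᵐᵒᵖ N]

variable (S M N L) in
/-- The left action on `M ⊗_S N` through the left factor, as a ring homomorphism. -/
def leftAct : L →+* AddMonoid.End (M ⊠[S] N) where
  toFun l := map
    { toFun := fun m => l • m, map_add' := smul_add l, map_smul' := fun s m => smul_comm l s m }
    LinearMap.id
  map_one' := hom_ext fun m n => congrArg (fun m' => tmul S m' n) (one_smul L m)
  map_mul' l l' := hom_ext fun m n => congrArg (fun m' => tmul S m' n) (mul_smul l l' m)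
  map_zero' := hom_ext fun m n =>
    (congrArg (fun m' => tmul S m' n) (zero_smul L m)).trans (zero_tmul n)
  map_add' l l' := hom_ext fun m n =>
    (congrArg (fun m' => tmul S m' n) (add_smul l l' m)).trans (add_tmul _ _ n)

/-- If `M` is an `L`-`S` bimodule, then `M ⊗_S N` is a left `L`-module. -/
instance (priority := high) leftModule : Module L (M ⊠[S] N) :=
  Module.compHom (M ⊠[S] N) (leftAct S M N L)

instance (priority := high) leftDistribMulAction : DistribMulAction L (M ⊠[S] N) :=
  leftModule.toDistribMulAction

instance (priority := high) leftMulAction : MulAction L (M ⊠[S] N) :=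
  leftDistribMulAction.toMulAction

instance (priority := high) leftDistribSMul : DistribSMul L (M ⊠[S] N) :=
  leftDistribMulAction.toDistribSMul

instance (priority := high) leftSMulZeroClass : SMulZeroClass L (M ⊠[S] N) :=
  leftDistribSMul.toSMulZeroClass

instance (priority := high) leftSMul : SMul L (M ⊠[S] N) :=
  leftModule.toSMul

@[simp] theorem smul_tmul_left (l : L) (m : M) (n : N) :
    l • tmul S m n = tmul S (l • m) n := rfl

variable (S M N Q) in
/-- The right action on `M ⊗_S N` through the right factor, as a ring homomorphism. -/
def rightAct : Qᵐᵒᵖ →+* AddMonoid.End (M ⊠[S] N) where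
  toFun q := map LinearMap.id
    { toFun := fun n => q • n, map_add' := smul_add q,
      map_smul' := fun s n => (smul_comm s q n).symm }
  map_one' := hom_ext fun m n => congrArg (tmul S m) (one_smul Qᵐᵒᵖ n)
  map_mul' q q' := hom_ext fun m n => congrArg (tmul S m) (mul_smul q q' n)
  map_zero' := hom_ext fun m n =>
    (congrArg (tmul S m) (zero_smul Qᵐᵒᵖ n)).trans (tmul_zero m)
  map_add' q q' := hom_ext fun m n =>
    (congrArg (tmul S m) (add_smul q q' n)).trans (tmul_add m _ _)

/-- If `N` is an `S`-`Q` bimodule, then `M ⊗_S N` is a right `Q`-module. -/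
instance (priority := high) rightModule : Module Qᵐᵒᵖ (M ⊠[S] N) :=
  Module.compHom (M ⊠[S] N) (rightAct S M N Q)

@[simp] theorem smul_tmul_right (q : Qᵐᵒᵖ) (m : M) (n : N) :
    q • tmul S m n = tmul S m (q • n) := rfl

instance : SMulCommClass L Qᵐᵒᵖ (M ⊠[S] N) where
  smul_comm l q z := by
    induction z using induction with
    | zero => simp
    | tmul m n => simp
    | add x y hx hy => simp only [smul_add, hx, hy]

end Actions

section Assoc

variable {S : Type*} [Ring S] {Q : Type*} [Ring Q] {M N P : Type*}
  [AddCommGroup M] [Module Sᵐᵒᵖ M] [AddCommGroup N] [Module S N] [Module Qᵐᵒᵖ N]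
  [SMulCommClass S Qᵐᵒᵖ N] [AddCommGroup P] [Module Q P]

/-- The map `m ⊗ n ↦ m ⊗ (n ⊗ p)`. -/
def assocAux (p : P) : M ⊠[S] N →+ M ⊠[S] (N ⊠[Q] P) :=
  map LinearMap.id
    { toFun := fun n => tmul Q n p
      map_add' := fun n n' => add_tmul n n' p
      map_smul' := fun s n => (smul_tmul_left s n p).symm }

/-- The map `n ⊗ p ↦ (m ⊗ n) ⊗ p`. -/
def assocInvAux (m : M) : N ⊠[Q] P →+ (M ⊠[S] N) ⊠[Q] P :=
  map
    { toFun := fun n => tmul S m n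
      map_add' := fun n n' => tmul_add m n n'
      map_smul' := fun q n => (smul_tmul_right q m n).symm }
    LinearMap.id

variable (S Q M N P) in
/-- The map `(m ⊗ n) ⊗ p ↦ m ⊗ (n ⊗ p)`. -/
def assocHom : (M ⊠[S] N) ⊠[Q] P →+ M ⊠[S] (N ⊠[Q] P) :=
  lift
    (AddMonoidHom.flip (AddMonoidHom.mk' assocAux
      (fun p p' => hom_ext fun m n =>
        (congrArg (tmul S m) (tmul_add n p p')).trans (tmul_add m _ _))))
    (fun z q p => by
      change assocAux p (op q • z) = assocAux (q • p) z
      induction z using induction with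
      | zero => rw [smul_zero, map_zero, map_zero]
      | tmul m n => exact congrArg (tmul S m) (smul_tmul n q p)
      | add x y hx hy => rw [smul_add, map_add, map_add, hx, hy])

variable (S Q M N P) in
/-- The map `m ⊗ (n ⊗ p) ↦ (m ⊗ n) ⊗ p`. -/
def assocInv : M ⊠[S] (N ⊠[Q] P) →+ (M ⊠[S] N) ⊠[Q] P :=
  lift
    (AddMonoidHom.mk' assocInvAux
      (fun m m' => hom_ext fun n p =>
        (congrArg (fun y => tmul Q y p) (add_tmul m m' n)).trans (add_tmul _ _ p)))
    (fun m s z => by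
      change assocInvAux (op s • m) z = assocInvAux m (s • z)
      induction z using induction with
      | zero => rw [smul_zero, map_zero, map_zero]
      | tmul n p => exact congrArg (fun y => tmul Q y p) (smul_tmul m s n)
      | add x y hx hy => rw [smul_add, map_add, map_add, hx, hy])

variable (S Q M N P) in
/-- The associativity isomorphism `(M ⊗_S N) ⊗_Q P ≃ M ⊗_S (N ⊗_Q P)`. -/
def assoc : (M ⊠[S] N) ⊠[Q] P ≃+ M ⊠[S] (N ⊠[Q] P) :=
  AddMonoidHom.toAddEquiv (assocHom S Q M N P) (assocInv S Q M N P)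
    (hom_ext fun z p => by
      induction z using induction with
      | zero => rw [zero_tmul, map_zero, map_zero]
      | tmul m n => rfl
      | add x y hx hy => rw [add_tmul, map_add, hx, hy, map_add])
    (hom_ext fun m z => by
      induction z using induction with
      | zero => rw [tmul_zero, map_zero, map_zero]
      | tmul n p => rfl
      | add x y hx hy => rw [tmul_add, map_add, hx, hy, map_add])

@[simp] theorem assoc_tmul (m : M) (n : N) (p : P) :
    assoc S Q M N P (tmul Q (tmul S m n) p) = tmul S m (tmul Q n p) := rfl

@[simp] theorem assoc_symm_tmul (m : M) (n : N) (p : P) :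
    (assoc S Q M N P).symm (tmul S m (tmul Q n p)) = tmul Q (tmul S m n) p := rfl

end Assoc

section Unit

variable {S : Type*} [Ring S] {M N : Type*}
  [AddCommGroup M] [Module Sᵐᵒᵖ M] [AddCommGroup N] [Module S N]

variable (S N) in
/-- The canonical map `S ⊗_S N → N`, `s ⊗ n ↦ s n`. -/
def lid : S ⊠[S] N →+ N :=
  lift (smulAddHom S N) (fun s t n => by simp [mul_smul])

variable (S M) in
/-- The canonical map `M ⊗_S S → M`, `m ⊗ s ↦ m s`. -/
def rid : M ⊠[S] S →+ M :=
  lift ((smulAddHom Sᵐᵒᵖ M).flip.compl₂ (opAddEquiv : S ≃+ Sᵐᵒᵖ).toAddMonoidHom)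
    (fun m s t => by simp [mul_smul])

@[simp] theorem lid_tmul (s : S) (n : N) : lid S N (tmul S s n) = s • n := rfl

@[simp] theorem rid_tmul (m : M) (s : S) : rid S M (tmul S m s) = op s • m := rfl

end Unit

end BTensor

open BTensor

/-- Homomorphisms of `S`-`Q` bimodules. -/
structure BimodHom (S Q M N : Type*) [Ring S] [Ring Q] [AddCommGroup M] [AddCommGroup N]
    [Module S M] [Module Qᵐᵒᵖ M] [Module S N] [Module Qᵐᵒᵖ N] extends M →+ N where
  map_smul' : ∀ (s : S) (m : M), toFun (s • m) = s • toFun m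
  map_op_smul' : ∀ (q : Q) (m : M), toFun (op q • m) = op q • toFun m

namespace BimodHom

variable {S Q M N : Type*} [Ring S] [Ring Q] [AddCommGroup M] [AddCommGroup N]
    [Module S M] [Module Qᵐᵒᵖ M] [Module S N] [Module Qᵐᵒᵖ N]

instance : CoeFun (BimodHom S Q M N) (fun _ => M → N) := ⟨fun f => ⇑f.toAddMonoidHom⟩

theorem apply_smul (f : BimodHom S Q M N) (s : S) (m : M) : f (s • m) = s • f m :=
  f.map_smul' s m

theorem apply_op_smul (f : BimodHom S Q M N) (q : Q) (m : M) : f (op q • m) = op q • f m :=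
  f.map_op_smul' q m

/-- The underlying left linear map. -/
def left (f : BimodHom S Q M N) : M →ₗ[S] N where
  toFun := f.toFun
  map_add' := f.map_add'
  map_smul' := f.map_smul'

/-- The underlying right linear map. -/
def right (f : BimodHom S Q M N) : M →ₗ[Qᵐᵒᵖ] N where
  toFun := f.toFun
  map_add' := f.map_add'
  map_smul' := fun q m => f.map_op_smul' q.unop m

end BimodHom

/-- A ring `A` with an `R`-`R` bimodule structure is an `R`-ring: both actions are induced by a
unit homomorphism `η : R → A`, that is `r a = η(r) a` and `a r = a η(r)`. -/
class IsRRing (R A : Type*) [Ring R] [Ring A] [Module R A] [Module Rᵐᵒᵖ A] : Prop where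
  exists_unit : ∃ η : R →+* A,
    (∀ (r : R) (a : A), r • a = η r * a) ∧ ∀ (r : R) (a : A), op r • a = a * η r

section RRing

variable {R A : Type*} [Ring R] [Ring A] [Module R A] [Module Rᵐᵒᵖ A] [IsRRing R A]

instance IsRRing.isScalarTower : IsScalarTower R A A where
  smul_assoc r a b := by
    obtain ⟨η, h, -⟩ := IsRRing.exists_unit (R := R) (A := A)
    simp [h, mul_assoc]

instance IsRRing.smulCommClass_op : SMulCommClass A Rᵐᵒᵖ A where
  smul_comm a r b := by
    obtain ⟨η, -, h⟩ := IsRRing.exists_unit (R := R) (A := A)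
    induction r using MulOpposite.rec'
    simp [h, mul_assoc]

instance IsRRing.smulCommClass : SMulCommClass R Rᵐᵒᵖ A where
  smul_comm r s b := by
    obtain ⟨η, h, h'⟩ := IsRRing.exists_unit (R := R) (A := A)
    induction s using MulOpposite.rec'
    simp [h, h', mul_assoc]

variable (R A) in
/-- The multiplication `A ⊗_R A → A` of an `R`-ring. -/
def rMul : BimodHom R R (A ⊠[R] A) A where
  toAddMonoidHom := lift AddMonoidHom.mul (fun a r b => by
    obtain ⟨η, h, h'⟩ := IsRRing.exists_unit (R := R) (A := A)
    simp [h, h', mul_assoc])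
  map_smul' r z := by
    change lift _ _ (r • z) = r • lift _ _ z
    induction z using BTensor.induction with
    | zero => simp
    | tmul m n => simp [smul_mul_assoc]
    | add x y hx hy => simp only [smul_add, map_add, hx, hy]
  map_op_smul' r z := by
    change lift _ _ (op r • z) = op r • lift _ _ z
    induction z using BTensor.induction with
    | zero => simp
    | tmul m n =>
      obtain ⟨η, h, h'⟩ := IsRRing.exists_unit (R := R) (A := A)
      simp [h', mul_assoc]
    | add x y hx hy => simp only [smul_add, map_add, hx, hy]

@[simp] theorem rMul_tmul (a b : A) : (rMul R A).right (tmul R a b) = a * b := rfl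

end RRing

/-- An `R`-coring structure on an `R`-`R` bimodule `C`. -/
class RCoring (R C : Type*) [Ring R] [AddCommGroup C] [Module R C] [Module Rᵐᵒᵖ C]
    [SMulCommClass R Rᵐᵒᵖ C] where
  /-- The coproduct. -/
  comul : BimodHom R R C (C ⊠[R] C)
  /-- The counit. -/
  counit : BimodHom R R C R
  coassoc : ∀ c : C, assoc R R C C C (map comul.right LinearMap.id (comul c))
    = map LinearMap.id comul.left (comul c)
  lid_counit : ∀ c : C, lid R C (map counit.right LinearMap.id (comul c)) = c
  rid_counit : ∀ c : C, rid R C (map LinearMap.id counit.left (comul c)) = c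

section Comodule

variable (R C : Type*) [Ring R] [AddCommGroup C] [Module R C] [Module Rᵐᵒᵖ C]
    [SMulCommClass R Rᵐᵒᵖ C] [RCoring R C]

/-- A right `C`-comodule structure on a right `R`-module `M`. -/
structure RightComodule (M : Type*) [AddCommGroup M] [Module Rᵐᵒᵖ M] where
  /-- The right coaction. -/
  coact : M →ₗ[Rᵐᵒᵖ] M ⊠[R] C
  coassoc : ∀ m : M, assoc R R M C C (map coact LinearMap.id (coact m))
    = map LinearMap.id (RCoring.comul (R := R) (C := C)).left (coact m)
  rid_counit : ∀ m : M,
    rid R M (map LinearMap.id (RCoring.counit (R := R) (C := C)).left (coact m)) = m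

/-- A left `C`-comodule structure on a left `R`-module `M`. -/
structure LeftComodule (M : Type*) [AddCommGroup M] [Module R M] where
  /-- The left coaction. -/
  coact : M →ₗ[R] C ⊠[R] M
  coassoc : ∀ m : M, assoc R R C C M
      (map (RCoring.comul (R := R) (C := C)).right LinearMap.id (coact m))
    = map LinearMap.id coact (coact m)
  lid_counit : ∀ m : M,
    lid R M (map (RCoring.counit (R := R) (C := C)).right LinearMap.id (coact m)) = m

end Comodule

section Entwining

variable {R A C : Type*} [Ring R] [Ring A] [Module R A] [Module Rᵐᵒᵖ A] [IsRRing R A]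
  [AddCommGroup C] [Module R C] [Module Rᵐᵒᵖ C] [SMulCommClass R Rᵐᵒᵖ C]

/-- For a bimodule map `ψ : C ⊗_R A → A ⊗_R C`, the map
`(μ_A ⊗_R C) ∘ (A ⊗_R ψ) : (A ⊗_R C) ⊗_R A → A ⊗_R C`, written `(a ⊗ c) a' = a ψ(c ⊗ a')`. -/
def entwinedAct (ψ : BimodHom R R (C ⊠[R] A) (A ⊠[R] C)) : (A ⊠[R] C) ⊠[R] A →+ A ⊠[R] C :=
  (map (rMul R A).right LinearMap.id).comp <|
    (assoc R R A A C).symm.toAddMonoidHom.comp <|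
      (map LinearMap.id ψ.left).comp (assoc R R A C A).toAddMonoidHom

variable (R A C) in
/-- A right entwining structure `(A, C, ψ)_R`. -/
structure RightEntwining [RCoring R C] where
  /-- The entwining map. -/
  ψ : BimodHom R R (C ⊠[R] A) (A ⊠[R] C)
  /-- `ψ ∘ (C ⊗ μ_A) = (μ_A ⊗ C) ∘ (A ⊗ ψ) ∘ (ψ ⊗ A)` -/
  ψ_mul : ∀ z : (C ⊠[R] A) ⊠[R] A,
    ψ (map LinearMap.id (rMul R A).left (assoc R R C A A z))
      = entwinedAct ψ (map ψ.right LinearMap.id z)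
  /-- `ψ ∘ (C ⊗ η_A) = η_A ⊗ C` -/
  ψ_one : ∀ c : C, ψ (tmul R c 1) = tmul R 1 c
  /-- `(A ⊗ Δ_C) ∘ ψ = (ψ ⊗ C) ∘ (C ⊗ ψ) ∘ (Δ_C ⊗ A)` -/
  comul_ψ : ∀ z : C ⊠[R] A,
    map LinearMap.id (RCoring.comul (R := R) (C := C)).left (ψ z)
      = assoc R R A C C (map ψ.right LinearMap.id
          ((assoc R R C A C).symm (map LinearMap.id ψ.left
            (assoc R R C C A
              (map (RCoring.comul (R := R) (C := C)).right LinearMap.id z)))))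
  /-- `(A ⊗ ε_C) ∘ ψ = ε_C ⊗ A` -/
  counit_ψ : ∀ z : C ⊠[R] A,
    rid R A (map LinearMap.id (RCoring.counit (R := R) (C := C)).left (ψ z))
      = lid R A (map (RCoring.counit (R := R) (C := C)).right LinearMap.id z)

variable (R A C) in
/-- A bijective right entwining structure `(A, C, ψ)_R` together with a right `C`-coaction `ρ` that
makes `A`, with its right regular action, a right entwined module. The corresponding entwined
extension is `B ⊆ A`, where `B` is the subalgebra of coinvariants. -/
structure EntwinedExtension [RCoring R C] extends RightEntwining R A C where
  bijective : Function.Bijective ψ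
  /-- The right coaction on `A`. -/
  ρ : RightComodule R C A
  /-- `ρ ∘ μ_A = (μ_A ⊗ C) ∘ (A ⊗ ψ) ∘ (ρ ⊗ A)` -/
  entwined : ∀ z : A ⊠[R] A,
    ρ.coact (rMul R A z) = entwinedAct ψ (map ρ.coact LinearMap.id z)

end Entwining

section Subalgebra

variable {k X M : Type*} [CommRing k] [Ring X] [Algebra k X] [AddCommGroup M]

/-- A right module over an algebra is a right module over each of its subalgebras. -/
instance Subalgebra.opModule [Module Xᵐᵒᵖ M] (S : Subalgebra k X) : Module (↥S)ᵐᵒᵖ M :=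
  Module.compHom M (RingHom.op (S.val : S →+* X))

theorem Subalgebra.op_smul_def [Module Xᵐᵒᵖ M] (S : Subalgebra k X) (s : S) (m : M) :
    op s • m = op (s : X) • m := rfl

instance Subalgebra.op_smulCommClass {L : Type*} [SMul L M] [Module Xᵐᵒᵖ M]
    [SMulCommClass L Xᵐᵒᵖ M] (S : Subalgebra k X) : SMulCommClass L (↥S)ᵐᵒᵖ M where
  smul_comm l s m := smul_comm l (op (s.unop : X)) m

end Subalgebra

namespace EntwinedExtension

variable {R A C : Type*} [Ring R] [Ring A] [Module R A] [Module Rᵐᵒᵖ A] [IsRRing R A]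
  [AddCommGroup C] [Module R C] [Module Rᵐᵒᵖ C] [SMulCommClass R Rᵐᵒᵖ C]

theorem entwinedAct_smul (ψ : BimodHom R R (C ⊠[R] A) (A ⊠[R] C)) (a : A) (z : A ⊠[R] C)
    (b : A) : entwinedAct ψ (tmul R (a • z) b) = a • entwinedAct ψ (tmul R z b) := by
  induction z using BTensor.induction with
  | zero => simp
  | tmul a' c =>
    have key : ∀ y : A ⊠[R] C,
        map (rMul R A).right LinearMap.id ((assoc R R A A C).symm (tmul R (a • a') y))
          = a • map (rMul R A).right LinearMap.id ((assoc R R A A C).symm (tmul R a' y)) := by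
      intro y
      induction y using BTensor.induction with
      | zero => simp
      | tmul d e => simp [mul_assoc]
      | add p q hp hq => simp only [BTensor.tmul_add, map_add, hp, hq, smul_add]
    exact key _
  | add p q hp hq => simp only [smul_add, BTensor.add_tmul, map_add, hp, hq]

variable [RCoring R C] (E : EntwinedExtension R A C)

theorem coact_mul (a b : A) :
    E.ρ.coact (a * b) = entwinedAct E.ψ (tmul R (E.ρ.coact a) b) :=
  E.entwined (tmul R a b)

theorem coact_mul_of_coinv {b : A} (hb : E.ρ.coact b = b • E.ρ.coact 1) (a : A) :
    E.ρ.coact (b * a) = b • E.ρ.coact a := by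
  rw [coact_mul, hb, entwinedAct_smul, ← coact_mul, one_mul]

/-- The inverse of the entwining map. -/
def ψinv : A ⊠[R] C → C ⊠[R] A :=
  (AddEquiv.ofBijective E.ψ.toAddMonoidHom E.bijective).symm

theorem ψ_ψinv (z : A ⊠[R] C) : E.ψ (E.ψinv z) = z :=
  (AddEquiv.ofBijective E.ψ.toAddMonoidHom E.bijective).apply_symm_apply z

theorem ψinv_ψ (z : C ⊠[R] A) : E.ψinv (E.ψ z) = z :=
  (AddEquiv.ofBijective E.ψ.toAddMonoidHom E.bijective).symm_apply_apply z

theorem ψ_op_smul (z : C ⊠[R] A) (b : A) :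
    E.ψ (op b • z) = entwinedAct E.ψ (tmul R (E.ψ z) b) := by
  rw [show entwinedAct E.ψ (tmul R (E.ψ z) b)
    = entwinedAct E.ψ (map E.ψ.right LinearMap.id (tmul R z b)) from rfl, ← E.ψ_mul]
  congr 1
  induction z using BTensor.induction with
  | zero => simp
  | tmul c a => rfl
  | add p q hp hq => rw [smul_add, hp, hq, BTensor.add_tmul, map_add, map_add]

/-- The left coaction `a ↦ ψ⁻¹(a ρ(1))` on `A`. -/
def lcoact : A →ₗ[R] C ⊠[R] A where
  toFun a := E.ψinv (a • E.ρ.coact 1)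
  map_add' a b := by
    rw [add_smul]
    exact (AddEquiv.ofBijective E.ψ.toAddMonoidHom E.bijective).symm.map_add _ _
  map_smul' r a := by
    apply E.bijective.1
    rw [RingHom.id_apply, E.ψ.apply_smul, ψ_ψinv, ψ_ψinv]
    induction E.ρ.coact (1 : A) using BTensor.induction with
    | zero => simp
    | tmul c a => simp [smul_mul_assoc]
    | add p q hp hq => rw [smul_add, smul_add, smul_add, hp, hq]

theorem lcoact_mul_of_coinv {b : A} (hb : E.ρ.coact b = b • E.ρ.coact 1) (a : A) :
    E.lcoact (a * b) = op b • E.lcoact a := by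
  apply E.bijective.1
  rw [ψ_op_smul]
  change E.ψ (E.ψinv _) = entwinedAct E.ψ (tmul R (E.ψ (E.ψinv _)) b)
  rw [ψ_ψinv, ψ_ψinv, entwinedAct_smul, ← coact_mul, one_mul, hb, mul_smul]

variable (k : Type*) [CommRing k] [Algebra k R] [Algebra k A] [IsScalarTower k R A]
  [Module k C] [IsScalarTower k R C] [IsScalarTower k Rᵐᵒᵖ C]

/-- The `k`-subalgebra `B = {b | ρ(b) = b ρ(1)}` of coinvariants of `A`. -/
def coinvariants : Subalgebra k A where
  carrier := {b | E.ρ.coact b = b • E.ρ.coact 1}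
  mul_mem' {a b} ha hb := by
    rw [Set.mem_ofPred_eq, E.coact_mul_of_coinv ha, hb, mul_smul]
  add_mem' {a b} ha hb := by
    rw [Set.mem_ofPred_eq] at *
    rw [map_add, ha, hb, add_smul]
  algebraMap_mem' c := by
    have h1 : ∀ a : A, op (algebraMap k R c) • a = algebraMap k A c * a := by
      intro a
      obtain ⟨η, h, h'⟩ := IsRRing.exists_unit (R := R) (A := A)
      have : η (algebraMap k R c) = algebraMap k A c := by
        have := h (algebraMap k R c) 1
        rw [algebraMap_smul, mul_one] at this
        rw [← this, Algebra.algebraMap_eq_smul_one]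
      rw [h', this, Algebra.commutes]
    have h2 : ∀ z : A ⊠[R] C, op (algebraMap k R c) • z = algebraMap k A c • z := by
      intro z
      induction z using BTensor.induction with
      | zero => simp
      | tmul a d =>
        have h3 : op (algebraMap k R c) • d = algebraMap k R c • d := by
          rw [algebraMap_smul]
          exact algebraMap_smul Rᵐᵒᵖ c d
        rw [smul_tmul_right, h3, ← BTensor.smul_tmul, h1, smul_tmul_left, smul_eq_mul]
      | add p q hp hq => rw [smul_add, smul_add, hp, hq]
    have h4 := h1 1
    rw [mul_one] at h4
    rw [Set.mem_ofPred_eq, ← h2, ← h4, map_smul]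

variable {k}
variable (T : Subalgebra k (E.coinvariants k))

/-- The right coaction on `A`, as a left `T`-linear map. -/
def coactT : A →ₗ[T] A ⊠[R] C where
  toFun := E.ρ.coact
  map_add' := map_add _
  map_smul' t a := E.coact_mul_of_coinv t.1.2 a

/-- The left coaction on `A`, as a right `T`-linear map. -/
def lcoactT : A →ₗ[(↥T)ᵐᵒᵖ] C ⊠[R] A where
  toFun := E.lcoact
  map_add' := map_add _
  map_smul' t a := E.lcoact_mul_of_coinv t.unop.1.2 a

/-- The lifted canonical map `A ⊗_T A → A ⊗_R C`, `a ⊗ a' ↦ a ρ(a')`. -/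
def canT : A ⊠[T] A →+ A ⊠[R] C :=
  lift ((smulAddHom A (A ⊠[R] C)).compl₂ (E.coactT T).toAddMonoidHom)
    (fun a t b => by
      change (a * (t : A)) • E.coactT T b = a • E.coactT T (t • b)
      rw [map_smul, mul_smul]
      rfl)

/-- A strong `T`-connection: a left and right `C`-comodule map `ℓ : C → A ⊗_T A`, for the coactions
`A ⊗_T ρ` and `λ ⊗_T A` (with `λ` the left coaction on `A`), such that
`canT (ℓ c) = 1 ⊗ c` for all `c`. -/
structure StrongConnection where
  /-- The underlying `R`-`R` bimodule map. -/
  ℓ : BimodHom R R C (A ⊠[T] A)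
  right_colinear : ∀ c : C,
    assoc T R A A C (map ℓ.right LinearMap.id (RCoring.comul (R := R) (C := C) c))
      = map LinearMap.id (E.coactT T) (ℓ c)
  left_colinear : ∀ c : C,
    map LinearMap.id ℓ.left (RCoring.comul (R := R) (C := C) c)
      = assoc R T C A A (map (E.lcoactT T) LinearMap.id (ℓ c))
  can_ℓ : ∀ c : C, E.canT T (ℓ c) = tmul R 1 c

variable (k) in
/-- The cotensor product `A □_C W`, the equaliser of `ρ ⊗ W` and `A ⊗ λ` in `A ⊗_R W`, as a left
module over the coinvariants `B` with action `b (a ⊗ w) = b a ⊗ w`. -/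
def cotensor {W : Type*} [AddCommGroup W] [Module R W] (lam : LeftComodule R C W) :
    Submodule (E.coinvariants k) (A ⊠[R] W) where
  carrier := {z | assoc R R A C W (map E.ρ.coact LinearMap.id z) = map LinearMap.id lam.coact z}
  zero_mem' := by simp
  add_mem' {x y} hx hy := by
    rw [Set.mem_ofPred_eq] at *
    rw [map_add, map_add, map_add, hx, hy]
  smul_mem' b z hz := by
    have h1 : ∀ y : A ⊠[R] W, assoc R R A C W (map E.ρ.coact LinearMap.id (b • y))
        = b • assoc R R A C W (map E.ρ.coact LinearMap.id y) := by
      intro y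
      induction y using BTensor.induction with
      | zero => simp
      | tmul a w =>
        have h : E.ρ.coact (b • a) = (b : A) • E.ρ.coact a := E.coact_mul_of_coinv b.2 a
        rw [smul_tmul_left, map_tmul, map_tmul, h]
        induction E.ρ.coact a using BTensor.induction with
        | zero => simp
        | tmul a' c => rfl
        | add p q hp hq => rw [smul_add, BTensor.add_tmul, map_add, hp, hq, BTensor.add_tmul,
            map_add, smul_add]
      | add p q hp hq => rw [smul_add, map_add, map_add, hp, hq, map_add, map_add, smul_add]
    have h2 : ∀ y : A ⊠[R] W,
        map (LinearMap.id : A →ₗ[Rᵐᵒᵖ] A) lam.coact (b • y)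
          = b • map (LinearMap.id : A →ₗ[Rᵐᵒᵖ] A) lam.coact y := by
      intro y
      induction y using BTensor.induction with
      | zero => simp
      | tmul a w => rfl
      | add p q hp hq => rw [smul_add, map_add, hp, hq, map_add, smul_add]
    rw [Set.mem_ofPred_eq] at *
    rw [h1, h2, hz]

end EntwinedExtension

section Flatness

/-- A left `S`-module `M` is flat: `- ⊗_S M` preserves injective maps of right `S`-modules. -/
def IsFlatLeft (S M : Type u) [Ring S] [AddCommGroup M] [Module S M] : Prop :=
  ∀ (N N' : Type u) [AddCommGroup N] [Module Sᵐᵒᵖ N] [AddCommGroup N'] [Module Sᵐᵒᵖ N']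
    (f : N →ₗ[Sᵐᵒᵖ] N'), Function.Injective f →
      Function.Injective (map f (LinearMap.id : M →ₗ[S] M))

/-- A right `S`-module `M` is faithfully flat: a sequence `N → N' → N''` of left `S`-modules is
exact if and only if `M ⊗_S N → M ⊗_S N' → M ⊗_S N''` is exact. -/
def IsFaithfullyFlatRight (S M : Type u) [Ring S] [AddCommGroup M] [Module Sᵐᵒᵖ M] : Prop :=
  ∀ (N N' N'' : Type u) [AddCommGroup N] [Module S N] [AddCommGroup N'] [Module S N']
    [AddCommGroup N''] [Module S N''] (f : N →ₗ[S] N') (g : N' →ₗ[S] N''),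
      Function.Exact f g ↔
        Function.Exact (map (LinearMap.id : M →ₗ[Sᵐᵒᵖ] M) f)
          (map (LinearMap.id : M →ₗ[Sᵐᵒᵖ] M) g)

end Flatness

section RelativeProjectivity

variable {k B M : Type*} [CommRing k] [Ring B] [Algebra k B] [AddCommGroup M] [Module B M]

/-- The multiplication map `B ⊗_T M → M`, `b ⊗ m ↦ b m`, for a subalgebra `T` of `B`. -/
def relMul (T : Subalgebra k B) (M : Type*) [AddCommGroup M] [Module B M] : B ⊠[T] M →+ M :=
  lift (smulAddHom B M) (fun b t m => mul_smul b (t : B) m)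

/-- A left `B`-module `M` is `T`-relative projective: the multiplication map `B ⊗_T M → M` has a
left `B`-linear section. -/
def IsRelProjective (T : Subalgebra k B) (M : Type*) [AddCommGroup M] [Module B M] : Prop :=
  ∃ σ : M →ₗ[B] B ⊠[T] M, ∀ m : M, relMul T M (σ m) = m

end RelativeProjectivity

end

/-! Write `ρ(a) = a₀ ⊗ a₁` and `w ↦ w₋₁ ⊗ w₀` for the coactions. The strong connection gives one
`A`-linear map `lower`, `a ⊗ w ↦ a ℓ(w₋₁) ⊗ w₀`, from `A ⊗_R W` to `A ⊗_T (A ⊗_R W)`. Its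
restriction to `Γ` is the section sought, for three reasons.

Right colinearity of `ℓ` and coassociativity of `W` put its values in the kernel of `A ⊗_T (ρ ⊗ W -
A ⊗ λ)`, where `λ` is the coaction of `W`. This kernel is `A ⊗_T Γ` because `A` is projective over
`T` (`exists_map_eq_lower`).

On `Γ` the map can be rewritten as `a ⊗ w ↦ a₀ ℓ(a₁) ⊗ w`. Left colinearity shows that `a₀ ℓ(a₁)` is
equalised by `ψ⁻¹ ∘ ρ` and the left coaction on its first leg. The equaliser of these two maps on
`A` is `B`, so flatness of `A` over `T` gives `a₀ ℓ(a₁) ∈ B ⊗_T A` (`extend_coact_mem_range`).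
Faithful flatness over `B` makes `B ⊗_T -` exact, so both restrictions hold at once: `lower` sends
`Γ` into `B ⊗_T Γ` (`exists_cotensorEmb_eq_lower`).

The canonical map condition on `ℓ` says that multiplying the two legs of `ℓ(c)` gives `ε(c)`, so
multiplication undoes `lower` (`actT_lower`).

For finite generation, let `G ⊆ Γ` be generated over `B` by the finitely many right legs of `lower
(1 ⊗ wᵢ)` in `A ⊗_T Γ`, with `wᵢ` generating `W`. By `A`-linearity every value of `lower` lies in
the `A`-span of such tensors. For `γ ∈ Γ`, the image of `lower γ` in `A ⊗_B Γ` is `1 ⊗ γ`, so `A ⊗_B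
G → A ⊗_B Γ` is onto, and faithful flatness gives `G = Γ`. -/

noncomputable section

open BTensor

namespace BTensor

/-! ### Exactness of tensoring with a projective right module, by dual bases. -/

section Exactness

variable {S : Type*} [Ring S] {M N N' N'' : Type*} [AddCommGroup M] [Module Sᵐᵒᵖ M]
  [AddCommGroup N] [Module S N] [AddCommGroup N'] [Module S N'] [AddCommGroup N''] [Module S N'']

variable (N) in
/-- A right linear map `M → I →₀ S` yields `M ⊗_S N → I →₀ N`, `m ⊗ n ↦ (i ↦ (s m)(i) n)`. -/
def coords {I : Type*} (s : M →ₗ[Sᵐᵒᵖ] (I →₀ Sᵐᵒᵖ)) : M ⊠[S] N →+ (I →₀ N) :=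
  lift
    (AddMonoidHom.mk' (fun m => AddMonoidHom.mk'
        (fun n => (s m).mapRange (fun q => q.unop • n) (by simp))
        (fun n n' => by ext; simp))
      (fun m m' => by ext; simp [add_smul]))
    (fun m t n => by
      ext i
      simp [mul_smul])

theorem coords_map {I : Type*} (s : M →ₗ[Sᵐᵒᵖ] (I →₀ Sᵐᵒᵖ)) (g : N →ₗ[S] N') (z : M ⊠[S] N) (i : I) :
    coords N' s (map LinearMap.id g z) i = g (coords N s z i) := by
  induction z using BTensor.induction with
  | zero => simp
  | tmul m n => simp [coords]
  | add x y hx hy => simp [hx, hy]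

/-- The sum `∑ i, e i ⊗ f i` for a finitely supported family `f`. -/
def sumAgainst {I : Type*} (e : I → M) : (I →₀ N) →+ M ⊠[S] N :=
  Finsupp.liftAddHom fun i => mk S M N (e i)

/-- The pair `(e, s)` is a dual basis of `M`, so a tensor is determined by its coordinates in `N`,
which are natural in `N` by `coords_map`. -/
theorem sumAgainst_coords {I : Type*} (s : M →ₗ[Sᵐᵒᵖ] (I →₀ Sᵐᵒᵖ)) (e : I → M)
    (h : ∀ m, Finsupp.linearCombination Sᵐᵒᵖ e (s m) = m) (z : M ⊠[S] N) :
    sumAgainst e (coords N s z) = z := by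
  induction z using BTensor.induction with
  | zero => simp
  | tmul m n =>
    conv_rhs => rw [← h m, Finsupp.linearCombination_apply, Finsupp.sum]
    change Finsupp.sum ((s m).mapRange (fun q => q.unop • n) (by simp)) (fun i => mk S M N (e i)) = _
    rw [Finsupp.sum_mapRange_index (by simp), Finsupp.sum]
    change _ = (mk S M N).flip n _
    rw [map_sum]
    exact Finset.sum_congr rfl fun i _ => (smul_tmul (e i) ((s m) i).unop n).symm
  | add x y hx hy => simp [hx, hy]

/-- If `M ⊗ g` kills `z`, then `g` kills each coordinate of `z`. Each coordinate therefore lifts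
along `f`, and the lifts are summed against the dual basis. -/
theorem exact_map_of_projective [Module.Projective Sᵐᵒᵖ M] (f : N →ₗ[S] N') (g : N' →ₗ[S] N'')
    (h : Function.Exact f g) :
    Function.Exact (map (LinearMap.id : M →ₗ[Sᵐᵒᵖ] M) f)
      (map (LinearMap.id : M →ₗ[Sᵐᵒᵖ] M) g) := by
  obtain ⟨s, hs⟩ := Module.Projective.out (R := Sᵐᵒᵖ) (P := M)
  intro z
  constructor
  · intro hz
    have h1 : ∀ i, ∃ n, f n = coords N' s z i := fun i => by
      apply (h _).1
      rw [← coords_map, hz, map_zero, Finsupp.zero_apply]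
    choose n hn using h1
    -- The dual basis is indexed by `M` itself, since `s` splits the canonical map from the free
    -- module on `M`; hence `e = id`.
    rw [← sumAgainst_coords s id hs z]
    change Finsupp.sum _ _ ∈ Set.range (map (LinearMap.id : M →ₗ[Sᵐᵒᵖ] M) f)
    rw [Finsupp.sum]
    rw [← AddMonoidHom.coe_range]
    refine sum_mem fun i _ => ⟨tmul S i (n i), ?_⟩
    rw [map_tmul, hn]
    rfl
  · rintro ⟨y, rfl⟩
    induction y using BTensor.induction with
    | zero => simp
    | tmul m n => simp [h.apply_apply_eq_zero]
    | add x y hx hy => simp [hx, hy]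

theorem map_id_injective_of_projective [Module.Projective Sᵐᵒᵖ M] (f : N →ₗ[S] N')
    (h : Function.Injective f) :
    Function.Injective (map (LinearMap.id : M →ₗ[Sᵐᵒᵖ] M) f) := by
  obtain ⟨s, hs⟩ := Module.Projective.out (R := Sᵐᵒᵖ) (P := M)
  rw [injective_iff_map_eq_zero]
  intro z hz
  have h1 : coords N s z = 0 := by
    ext i
    apply h
    rw [← coords_map, hz, map_zero, Finsupp.zero_apply, Finsupp.zero_apply, map_zero]
  rw [← sumAgainst_coords s id hs z, h1, map_zero]

end Exactness

/-! ### Kernels of maps tensored with a flat left module. -/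

section RightExact

variable {S : Type u} [Ring S] {M N N' : Type u} [AddCommGroup M] [Module S M]
  [AddCommGroup N] [Module Sᵐᵒᵖ N] [AddCommGroup N'] [Module Sᵐᵒᵖ N']

/-- Right exactness of `- ⊗_S M`: the universal property gives a map `F` from `(N ⧸ K) ⊗ M` back to
`(N ⊗ M) ⧸ G` through which the quotient by `G` factors. -/
theorem mem_range_of_map_mkQ_eq_zero (K : Submodule Sᵐᵒᵖ N) (z : N ⊠[S] M)
    (hz : map K.mkQ (LinearMap.id : M →ₗ[S] M) z = 0) :
    z ∈ (map K.subtype (LinearMap.id : M →ₗ[S] M)).range := by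
  set G := (map K.subtype (LinearMap.id : M →ₗ[S] M)).range
  let F₀ : N →+ M →+ (N ⊠[S] M) ⧸ G :=
    AddMonoidHom.mk' (fun n => (QuotientAddGroup.mk' G).comp (mk S N M n))
      (fun n n' => AddMonoidHom.ext fun m => congrArg (QuotientAddGroup.mk' G) (add_tmul n n' m))
  let F : (N ⧸ K) ⊠[S] M →+ (N ⊠[S] M) ⧸ G :=
    lift (QuotientAddGroup.lift K.toAddSubgroup F₀
        (fun n hn => AddMonoidHom.ext fun m =>
          (QuotientAddGroup.eq_zero_iff (N := G) (tmul S n m)).2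
            (AddMonoidHom.mem_range.2 ⟨tmul S (⟨n, hn⟩ : K) m, rfl⟩)))
      (fun n s m => by
        obtain ⟨n, rfl⟩ := K.mkQ_surjective n
        exact congrArg (QuotientAddGroup.mk' G) (smul_tmul n s m))
  have hF : ∀ z : N ⊠[S] M, F (map K.mkQ LinearMap.id z) = QuotientAddGroup.mk' G z := by
    intro z
    induction z using BTensor.induction with
    | zero => simp
    | tmul n m => rfl
    | add x y hx hy => rw [map_add, map_add, hx, hy, map_add]
  have := hF z
  rw [hz, map_zero] at this
  exact (QuotientAddGroup.eq_zero_iff _).1 this.symm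

/-- Factor `f` through `N ⧸ ker f`. The injective factor stays injective after tensoring by
flatness, which leaves the quotient map. -/
theorem mem_range_ker_of_map_eq_zero (h : IsFlatLeft S M) (f : N →ₗ[Sᵐᵒᵖ] N') (z : N ⊠[S] M)
    (hz : map f (LinearMap.id : M →ₗ[S] M) z = 0) :
    z ∈ (map (LinearMap.ker f).subtype (LinearMap.id : M →ₗ[S] M)).range := by
  apply mem_range_of_map_mkQ_eq_zero
  apply h _ _ ((LinearMap.ker f).liftQ f le_rfl)
    (LinearMap.ker_eq_bot.1 (Submodule.ker_liftQ_eq_bot _ _ _ le_rfl))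
  rw [map_zero, ← hz]
  generalize z = z
  induction z using BTensor.induction with
  | zero => simp
  | tmul n m => rfl
  | add x y hx hy => rw [map_add, map_add, hx, hy, map_add]

end RightExact

/-! ### Descent from `A` to `B`: exactness of `B ⊗_T -` and the inclusion `B ⊗_T N ⊆ A ⊗_T N`. -/

section BaseChange

/-- The map `M ⊗_S f` as a left linear map for a left action on `M`. -/
def lTensor (L M : Type*) [Ring L] {S : Type*} [Ring S] [AddCommGroup M] [Module L M]
    [Module Sᵐᵒᵖ M] [SMulCommClass L Sᵐᵒᵖ M] {N N' : Type*} [AddCommGroup N] [Module S N]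
    [AddCommGroup N'] [Module S N'] (f : N →ₗ[S] N') : M ⊠[S] N →ₗ[L] M ⊠[S] N' where
  toFun := map LinearMap.id f
  map_add' := map_add _
  map_smul' l z := by
    rw [RingHom.id_apply]
    induction z using BTensor.induction with
    | zero => simp
    | tmul n m => rfl
    | add x y hx hy => rw [smul_add, map_add, map_add, hx, hy, smul_add]

variable {k A : Type u} [CommRing k] [Ring A] [Algebra k A] {B : Subalgebra k A}
  (T : Subalgebra k B) (N : Type u) {N' N'' : Type u} [AddCommGroup N] [Module T N]
  [AddCommGroup N'] [Module T N'] [AddCommGroup N''] [Module T N'']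

/-- The inclusion `B → A` as a right `T`-linear map. -/
def inclRight : B →ₗ[(↥T)ᵐᵒᵖ] A where
  toFun b := b
  map_add' _ _ := rfl
  map_smul' _ _ := rfl

/-- The inclusion-induced map `B ⊗_T N → A ⊗_T N`, as a left `B`-linear map. -/
def inclTensor : B ⊠[T] N →ₗ[B] A ⊠[T] N where
  toFun := map (inclRight T) LinearMap.id
  map_add' := map_add _
  map_smul' l z := by
    rw [RingHom.id_apply]
    induction z using BTensor.induction with
    | zero => simp
    | tmul n m => rfl
    | add x y hx hy => rw [smul_add, map_add, map_add, hx, hy, smul_add]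

/-- The cancellation map `A ⊗_B (A ⊗_T N) → A ⊗_T N`, `a ⊗ (a' ⊗ n) ↦ a a' ⊗ n`. -/
def actMap : A ⊠[B] (A ⊠[T] N) →+ A ⊠[T] N :=
  lift (smulAddHom A (A ⊠[T] N)) (fun a b z => by
    change (a * (b : A)) • z = a • ((b : A) • z)
    exact mul_smul _ _ _)

/-- The map `A ⊗_T N → A ⊗_B (B ⊗_T N)`, `a ⊗ n ↦ a ⊗ (1 ⊗ n)`, inverse to `collapse`. -/
def expand : A ⊠[T] N →+ A ⊠[B] (B ⊠[T] N) :=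
  lift (AddMonoidHom.mk' (fun a => AddMonoidHom.mk' (fun n => tmul B a (tmul T (1 : B) n))
        (fun n n' => by rw [tmul_add, tmul_add]))
      (fun a a' => AddMonoidHom.ext fun n => add_tmul _ _ _))
    (fun a t n => by
      change tmul B (op (t : B) • a) (tmul T (1 : B) n) = tmul B a (tmul T (1 : B) (t • n))
      rw [smul_tmul, ← BTensor.smul_tmul (1 : B) t n, smul_tmul_left]
      congr 2
      change (t : B) * 1 = 1 * (t : B)
      rw [mul_one, one_mul])

/-- The map `A ⊗_B (B ⊗_T N) → A ⊗_T N`, `a ⊗ (b ⊗ n) ↦ a b ⊗ n`. -/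
def collapse : A ⊠[B] (B ⊠[T] N) →+ A ⊠[T] N :=
  (actMap T N).comp (map LinearMap.id (inclTensor T N))

theorem expand_collapse (z : A ⊠[B] (B ⊠[T] N)) : expand T N (collapse T N z) = z := by
  induction z using BTensor.induction with
  | zero => simp
  | tmul a z =>
    induction z using BTensor.induction with
    | zero => simp
    | tmul b n =>
      change tmul B (op b • a) (tmul T (1 : B) n) = _
      rw [smul_tmul, smul_tmul_left, smul_eq_mul, mul_one]
    | add x y hx hy => rw [tmul_add, map_add, map_add, hx, hy]
  | add x y hx hy => rw [map_add, map_add, hx, hy]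

theorem collapse_expand (z : A ⊠[T] N) : collapse T N (expand T N z) = z := by
  induction z using BTensor.induction with
  | zero => simp
  | tmul a n =>
    change tmul T (a * ((1 : B) : A)) n = _
    simp
  | add x y hx hy => rw [map_add, map_add, hx, hy]

variable {N}

theorem collapse_map (f : N →ₗ[T] N') (z : A ⊠[B] (B ⊠[T] N)) :
    collapse T N' (map LinearMap.id (lTensor B B f) z)
      = map LinearMap.id f (collapse T N z) := by
  induction z using BTensor.induction with
  | zero => simp
  | tmul a z =>
    induction z using BTensor.induction with
    | zero => simp
    | tmul b n => rfl
    | add x y hx hy => rw [tmul_add, map_add, map_add, hx, hy, map_add, map_add]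
  | add x y hx hy => rw [map_add, map_add, hx, hy, map_add, map_add]

/-- Exactness may be tested after `A ⊗_B -`. There `collapse` identifies `A ⊗_B (B ⊗_T -)` with `A
⊗_T -`, which is exact by projectivity. -/
theorem exact_map_of_faithfullyFlat (hff : IsFaithfullyFlatRight B A)
    [Module.Projective (↥T)ᵐᵒᵖ A] (f : N →ₗ[T] N') (g : N' →ₗ[T] N'') (h : Function.Exact f g) :
    Function.Exact (map (LinearMap.id : B →ₗ[(↥T)ᵐᵒᵖ] B) f)
      (map (LinearMap.id : B →ₗ[(↥T)ᵐᵒᵖ] B) g) := by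
  refine (hff _ _ _ (lTensor B B f) (lTensor B B g)).2 fun z => ?_
  have h1 := exact_map_of_projective (M := A) f g h (collapse T N' z)
  rw [← collapse_map] at h1
  constructor
  · intro hz
    rw [hz, map_zero] at h1
    obtain ⟨y, hy⟩ := h1.1 rfl
    refine ⟨expand T N y, ?_⟩
    rw [← expand_collapse T N' z, ← hy, ← expand_collapse T N' (map _ _ _), collapse_map,
      collapse_expand]
  · rintro ⟨y, rfl⟩
    rw [← expand_collapse T N'' (map _ _ _), h1.2 ⟨collapse T N y, (collapse_map T f y).symm⟩,
      map_zero]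

-- After `A ⊗_B -` the inclusion has the retraction `a ⊗ (a' ⊗ n) ↦ a a' ⊗ n`, up to `collapse`;
-- injectivity then descends.
variable (N) in
theorem inclTensor_injective (hff : IsFaithfullyFlatRight B A) :
    Function.Injective (inclTensor T N) := by
  have h1 : Function.Injective
      (map (LinearMap.id : A →ₗ[(↥B)ᵐᵒᵖ] A) (inclTensor T N)) := by
    intro x y hxy
    rw [← expand_collapse T N x, ← expand_collapse T N y]
    exact congrArg (fun z => expand T N (actMap T N z)) hxy
  -- Faithful flatness speaks of exact sequences, so injectivity is encoded as exactness of `0 → B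
  -- ⊗_T N → A ⊗_T N`, with `PUnit` as the zero module.
  have h2 : Function.Exact (0 : PUnit.{u + 1} →ₗ[B] B ⊠[T] N) (inclTensor T N) := by
    refine (hff _ _ _ _ _).2 fun z => ?_
    have h0 : map (LinearMap.id : A →ₗ[(↥B)ᵐᵒᵖ] A) (0 : PUnit.{u + 1} →ₗ[B] B ⊠[T] N) = 0 :=
      hom_ext fun m n => by simp
    rw [h0, map_eq_zero_iff _ h1]
    simp [eq_comm]
  rw [injective_iff_map_eq_zero]
  intro z hz
  obtain ⟨y, rfl⟩ := (h2 z).1 hz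
  rfl

/-- Surjectivity descends along a faithfully flat right module. -/
theorem surjective_of_faithfullyFlat {S M : Type u} [Ring S] [AddCommGroup M] [Module Sᵐᵒᵖ M]
    (hff : IsFaithfullyFlatRight S M) {P Q : Type u} [AddCommGroup P] [Module S P]
    [AddCommGroup Q] [Module S Q] (f : P →ₗ[S] Q)
    (h : Function.Surjective (map (LinearMap.id : M →ₗ[Sᵐᵒᵖ] M) f)) : Function.Surjective f := by
  have h1 : Function.Exact f (0 : Q →ₗ[S] PUnit.{u + 1}) := by
    refine (hff _ _ _ _ _).2 fun z => ⟨fun _ => h z, fun _ => ?_⟩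
    rw [show map (LinearMap.id : M →ₗ[Sᵐᵒᵖ] M) (0 : Q →ₗ[S] PUnit.{u + 1}) = 0 from
      hom_ext fun m n => tmul_zero m]
    rfl
  exact fun q => (h1 q).1 rfl

end BaseChange

end BTensor

/-! ### Additivity and linearity of maps between tensor products. -/

namespace BTensor

variable {S : Type*} [Ring S] {M M' N N' : Type*} [AddCommGroup M] [Module Sᵐᵒᵖ M]
  [AddCommGroup M'] [Module Sᵐᵒᵖ M'] [AddCommGroup N] [Module S N] [AddCommGroup N'] [Module S N']

theorem map_add_left {f f₁ : M →ₗ[Sᵐᵒᵖ] M'} (f₂ : M →ₗ[Sᵐᵒᵖ] M') (h : ∀ m, f m = f₁ m + f₂ m)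
    (g : N →ₗ[S] N') (z : M ⊠[S] N) : map f g z = map f₁ g z + map f₂ g z := by
  induction z using BTensor.induction with
  | zero => simp
  | tmul m n => rw [map_tmul, h, add_tmul]; rfl
  | add x y hx hy => rw [map_add, map_add, map_add, hx, hy]; abel

theorem map_smul_left {L : Type*} [Ring L] [Module L M] [SMulCommClass L Sᵐᵒᵖ M] (l : L)
    (f f' : M →ₗ[Sᵐᵒᵖ] M') (h : ∀ m, f (l • m) = f' m) (g : N →ₗ[S] N') (z : M ⊠[S] N) :
    map f g (l • z) = map f' g z := by
  induction z using BTensor.induction with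
  | zero => simp
  | tmul m n => rw [smul_tmul_left, map_tmul, h]; rfl
  | add x y hx hy => rw [smul_add, map_add, map_add, hx, hy]

theorem map_sub_left (f f' : M →ₗ[Sᵐᵒᵖ] M') (g : N →ₗ[S] N') (z : M ⊠[S] N) :
    map (f - f') g z = map f g z - map f' g z :=
  eq_sub_of_add_eq (map_add_left (f := f) f' (f₁ := f - f') (by simp) g z).symm

theorem map_sub_right (f : M →ₗ[Sᵐᵒᵖ] M') (g g' : N →ₗ[S] N') (z : M ⊠[S] N) :
    map f (g - g') z = map f g z - map f g' z := by
  induction z using BTensor.induction with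
  | zero => simp
  | tmul m n => exact (mk S M' N' (f m)).map_sub _ _
  | add x y hx hy => rw [map_add, map_add, map_add, hx, hy]; abel

theorem assoc_symm_smul {L Q P : Type*} [Ring L] [Ring Q] [Module L M] [SMulCommClass L Sᵐᵒᵖ M]
    [Module Qᵐᵒᵖ N] [SMulCommClass S Qᵐᵒᵖ N] [AddCommGroup P] [Module Q P] (l : L)
    (z : M ⊠[S] (N ⊠[Q] P)) : (assoc S Q M N P).symm (l • z) = l • (assoc S Q M N P).symm z := by
  induction z using BTensor.induction with
  | zero => simp
  | tmul m u =>
    induction u using BTensor.induction with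
    | zero => simp
    | tmul a b => rfl
    | add x y hx hy => rw [tmul_add, smul_add, map_add, hx, hy, map_add, smul_add]
  | add x y hx hy => rw [smul_add, map_add, hx, hy, map_add, smul_add]

theorem assoc_smul {L Q P : Type*} [Ring L] [Ring Q] [Module L M] [SMulCommClass L Sᵐᵒᵖ M]
    [Module Qᵐᵒᵖ N] [SMulCommClass S Qᵐᵒᵖ N] [AddCommGroup P] [Module Q P] (l : L)
    (z : (M ⊠[S] N) ⊠[Q] P) : assoc S Q M N P (l • z) = l • assoc S Q M N P z := by
  rw [← (assoc S Q M N P).symm.injective.eq_iff, assoc_symm_smul]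
  simp

/-- For a family of right linear maps `Θ m : N ⊗_S P → Y`, additive in `m` and balanced, the map
`m ⊗ (n ⊗ (p ⊗ q)) ↦ Θ m (n ⊗ p) ⊗ q`. -/
def actTensor {R X P Y Z : Type*} [Ring R] [AddCommGroup X] [Module Rᵐᵒᵖ X] [Module R M]
    [SMulCommClass R Sᵐᵒᵖ M] {Q : Type*} [Ring Q] [AddCommGroup P] [Module S P]
    [Module Qᵐᵒᵖ P] [SMulCommClass S Qᵐᵒᵖ P] [AddCommGroup Y] [Module Qᵐᵒᵖ Y]
    [AddCommGroup Z] [Module Q Z]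
    (Θ : X → M ⊠[S] P →ₗ[Qᵐᵒᵖ] Y) (hadd : ∀ x x' z, Θ (x + x') z = Θ x z + Θ x' z)
    (hsmul : ∀ x (r : R) z, Θ (op r • x) z = Θ x (r • z)) :
    X ⊠[R] (M ⊠[S] (P ⊠[Q] Z)) →+ Y ⊠[Q] Z :=
  lift
    (AddMonoidHom.mk' (fun x => (map (Θ x) LinearMap.id).comp
        (assoc S Q M P Z).symm.toAddMonoidHom)
      (fun x x' => AddMonoidHom.ext fun _ => map_add_left _ (hadd x x') _ _))
    (fun x r z => (map_smul_left r (Θ x) (Θ (op r • x))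
      (fun y => (hsmul x r y).symm) _ _).symm.trans
      (congrArg (map (Θ x) LinearMap.id) (assoc_symm_smul r z).symm))

end BTensor

/-! ### Extension of scalars from `R` to `A`. -/

section ScalarExtension

variable {R A : Type*} [Ring R] [Ring A] [Module R A] [Module Rᵐᵒᵖ A] [IsRRing R A]

theorem IsRRing.op_smul_smul {Z : Type*} [AddCommGroup Z] [Module A Z] [Module R Z]
    [IsScalarTower R A Z] (a : A) (r : R) (z : Z) : (op r • a) • z = a • (r • z) := by
  obtain ⟨η, h, h'⟩ := IsRRing.exists_unit (R := R) (A := A)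
  have h1 : r • z = η r • z := by
    conv_lhs => rw [← one_smul A z]
    rw [← smul_assoc, h, mul_one]
  rw [h', mul_smul, h1]

instance BTensor.isScalarTower_left {S M N : Type*} [Ring S] [AddCommGroup M] [Module Sᵐᵒᵖ M]
    [AddCommGroup N] [Module S N] [Module A M] [SMulCommClass A Sᵐᵒᵖ M] [Module R M]
    [SMulCommClass R Sᵐᵒᵖ M] [IsScalarTower R A M] : IsScalarTower R A (M ⊠[S] N) where
  smul_assoc r a z := by
    induction z using BTensor.induction with
    | zero => simp
    | tmul m n => simp
    | add x y hx hy => simp only [smul_add, hx, hy]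

/-- The left `A`-linear extension `a ⊗ n ↦ a • g n` of a left `R`-linear map `g`. -/
def extendScalars {N Z : Type*} [AddCommGroup N] [Module R N] [AddCommGroup Z] [Module A Z]
    [Module R Z] [IsScalarTower R A Z] (g : N →ₗ[R] Z) : A ⊠[R] N →ₗ[A] Z where
  toFun := lift ((smulAddHom A Z).compl₂ g.toAddMonoidHom)
    (fun a r n => by
      change (op r • a) • g n = a • g (r • n)
      rw [map_smul, IsRRing.op_smul_smul])
  map_add' := map_add _
  map_smul' a z := by
    rw [RingHom.id_apply]
    induction z using BTensor.induction with
    | zero => simp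
    | tmul a' n => exact mul_smul a a' (g n)
    | add x y hx hy => rw [smul_add, map_add, map_add, hx, hy, smul_add]

end ScalarExtension

/-! ### The left `A`-action on `C ⊗_R A` transported along `ψ`, and the two maps that cut out `B`.
-/

namespace EntwinedExtension

variable {R A C : Type*} [Ring R] [Ring A] [Module R A] [Module Rᵐᵒᵖ A] [IsRRing R A]
  [AddCommGroup C] [Module R C] [Module Rᵐᵒᵖ C] [SMulCommClass R Rᵐᵒᵖ C]
  [RCoring R C] (E : EntwinedExtension R A C)

theorem ψinv_add (y z : A ⊠[R] C) : E.ψinv (y + z) = E.ψinv y + E.ψinv z :=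
  (AddEquiv.ofBijective E.ψ.toAddMonoidHom E.bijective).symm.map_add y z

/-- The left `A`-action `a ▹ z = ψ⁻¹(a ψ(z))` on `C ⊗_R A`, as a right `A`-linear map. -/
def leftMul (a : A) : C ⊠[R] A →ₗ[Aᵐᵒᵖ] C ⊠[R] A where
  toFun z := E.ψinv (a • E.ψ z)
  map_add' y z := by rw [map_add, smul_add, ψinv_add]
  map_smul' b z := by
    apply E.bijective.1
    induction b using MulOpposite.rec' with
    | _ b =>
    rw [RingHom.id_apply, ψ_op_smul, ψ_ψinv, ψ_op_smul, ψ_ψinv, entwinedAct_smul]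

theorem ψ_leftMul (a : A) (z : C ⊠[R] A) : E.ψ (E.leftMul a z) = a • E.ψ z := E.ψ_ψinv _

theorem leftMul_add (a a' : A) (z : C ⊠[R] A) :
    E.leftMul (a + a') z = E.leftMul a z + E.leftMul a' z := by
  apply E.bijective.1
  rw [map_add, ψ_leftMul, ψ_leftMul, ψ_leftMul, add_smul]

theorem leftMul_op_smul (a : A) (r : R) (z : C ⊠[R] A) :
    E.leftMul (op r • a) z = E.leftMul a (r • z) := by
  apply E.bijective.1
  rw [ψ_leftMul, ψ_leftMul, E.ψ.apply_smul, IsRRing.op_smul_smul]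

/-- After applying `ψ`, both sides are `(a b) ρ(1)`. This is the left-hand counterpart of the
entwined module condition. -/
theorem lcoact_mul (a b : A) : E.lcoact (a * b) = E.leftMul a (E.lcoact b) := by
  apply E.bijective.1
  change E.ψ (E.ψinv ((a * b) • E.ρ.coact 1)) = E.ψ (E.leftMul a (E.ψinv (b • E.ρ.coact 1)))
  rw [ψ_leftMul, ψ_ψinv, ψ_ψinv, mul_smul]

variable {k : Type*} [CommRing k] [Algebra k R] [Algebra k A] [IsScalarTower k R A]
  [Module k C] [IsScalarTower k R C] [IsScalarTower k Rᵐᵒᵖ C]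
  (T : Subalgebra k (E.coinvariants k))

/-- The map `a ↦ ψ⁻¹(ρ(a))`, as a right `T`-linear map. -/
def rcoactT : A →ₗ[(↥T)ᵐᵒᵖ] C ⊠[R] A where
  toFun a := E.ψinv (E.ρ.coact a)
  map_add' a b := by rw [map_add, ψinv_add]
  map_smul' t a := by
    apply E.bijective.1
    change E.ψ (E.ψinv (E.ρ.coact (a * ((t.unop : E.coinvariants k) : A))))
      = E.ψ (op ((t.unop : E.coinvariants k) : A) • E.ψinv (E.ρ.coact a))
    rw [ψ_op_smul, ψ_ψinv, ψ_ψinv, coact_mul]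

theorem ψ_rcoactT (a : A) : E.ψ (E.rcoactT T a) = E.ρ.coact a := E.ψ_ψinv _

/-- The action `leftMul` as a right `T`-linear map. -/
def leftMulT (a : A) : C ⊠[R] A →ₗ[(↥T)ᵐᵒᵖ] C ⊠[R] A where
  toFun := E.leftMul a
  map_add' := map_add _
  map_smul' t z := (E.leftMul a).map_smul (op ((t.unop : E.coinvariants k) : A)) z

/-- Applying `ψ` turns the hypothesis into `ρ(a) = a ρ(1)`. Thus `B` is described by two right
`T`-linear maps, which can be tensored over `T`. -/
theorem mem_coinvariants_of_coact_eq {a : A} (h : E.rcoactT T a = E.lcoactT T a) :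
    a ∈ E.coinvariants k := by
  have h1 := congrArg E.ψ h
  rw [ψ_rcoactT] at h1
  exact h1.trans (E.ψ_ψinv _)

/-- The map `a ⊗ (c ⊗ (a' ⊗ a'')) ↦ (a ▹ (c ⊗ a')) ⊗ a''`. -/
def leftMulTensor : A ⊠[R] (C ⊠[R] (A ⊠[T] A)) →+ (C ⊠[R] A) ⊠[T] A :=
  actTensor (E.leftMulT T) E.leftMul_add E.leftMul_op_smul

theorem map_lcoactT_smul (a : A) (u : A ⊠[T] A) :
    map (E.lcoactT T) (LinearMap.id : A →ₗ[T] A) (a • u)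
      = map (E.leftMulT T a) LinearMap.id (map (E.lcoactT T) LinearMap.id u) := by
  induction u using BTensor.induction with
  | zero => simp
  | tmul a' b => exact congrArg (fun w => tmul T w b) (E.lcoact_mul a a')
  | add x y hx hy => simp only [smul_add, map_add, hx, hy]

/-- The entwined module condition reads `ρ(a a') = a₀ ψ(a₁ ⊗ a')`, so `ψ⁻¹(ρ(a a')) = a₀ ▹ (a₁ ⊗
a')`. -/
theorem map_rcoactT_smul (a : A) (u : A ⊠[T] A) :
    map (E.rcoactT T) (LinearMap.id : A →ₗ[T] A) (a • u)
      = E.leftMulTensor T (assoc R R A C (A ⊠[T] A) (tmul R (E.ρ.coact a) u)) := by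
  induction u using BTensor.induction with
  | zero => simp
  | tmul a' b =>
    have h : ∀ y : A ⊠[R] C, tmul T (E.ψinv (entwinedAct E.ψ (tmul R y a'))) b
        = E.leftMulTensor T (assoc R R A C (A ⊠[T] A) (tmul R y (tmul T a' b))) := by
      intro y
      induction y using BTensor.induction with
      | zero =>
        rw [BTensor.zero_tmul, BTensor.zero_tmul, map_zero, map_zero, map_zero]
        have : E.ψinv 0 = 0 :=
          (AddEquiv.ofBijective E.ψ.toAddMonoidHom E.bijective).symm.map_zero
        rw [this, BTensor.zero_tmul]
      | tmul a c =>
        change _ = tmul T (E.ψinv (a • E.ψ (tmul R c a'))) b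
        congr 2
        change map (rMul R A).right LinearMap.id
          ((assoc R R A A C).symm (tmul R a (E.ψ (tmul R c a')))) = _
        induction E.ψ (tmul R c a') using BTensor.induction with
        | zero => simp
        | tmul d e => rfl
        | add p q hp hq => rw [BTensor.tmul_add, map_add, map_add, hp, hq, smul_add]
      | add p q hp hq =>
        rw [BTensor.add_tmul, BTensor.add_tmul, map_add, map_add, map_add, ψinv_add,
          BTensor.add_tmul, hp, hq]
    rw [← h, ← coact_mul]
    rfl
  | add x y hx hy => rw [smul_add, map_add, hx, hy, BTensor.tmul_add, map_add, map_add]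

/-! ### The two maps evaluated on `a ℓ(c)`. -/

namespace StrongConnection

variable {E T} (s : E.StrongConnection T)

/-- The map `A ⊗_R C → A ⊗_T A`, `a ⊗ c ↦ a ℓ(c)`. -/
def extend : A ⊠[R] C →ₗ[A] A ⊠[T] A := extendScalars s.ℓ.left

theorem extend_tmul (a : A) (c : C) : s.extend (tmul R a c) = a • s.ℓ c := rfl

/-- On `a ⊗ c`, left colinearity of `ℓ` gives `a ▹ (c₁ ⊗ ℓ(c₂))`. The companion `map_rcoactT_extend`
gives `a₀ ▹ (a₁ ⊗ ℓ(c))`, so only the element fed to the common map differs. -/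
theorem map_lcoactT_extend (y : A ⊠[R] C) :
    map (E.lcoactT T) (LinearMap.id : A →ₗ[T] A) (s.extend y)
      = E.leftMulTensor T (map LinearMap.id
          (show C ⊠[R] C →ₗ[R] C ⊠[R] (A ⊠[T] A) from lTensor R C s.ℓ.left)
          (map LinearMap.id (RCoring.comul (R := R) (C := C)).left y)) := by
  induction y using BTensor.induction with
  | zero => simp
  | tmul a c =>
    change _ = map (E.leftMulT T a) LinearMap.id ((assoc R T C A A).symm
      (map LinearMap.id s.ℓ.left (RCoring.comul (R := R) (C := C) c)))
    rw [extend_tmul, map_lcoactT_smul, s.left_colinear, AddEquiv.symm_apply_apply]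
  | add p q hp hq => simp only [map_add, hp, hq]

theorem map_rcoactT_extend (y : A ⊠[R] C) :
    map (E.rcoactT T) (LinearMap.id : A →ₗ[T] A) (s.extend y)
      = E.leftMulTensor T (map LinearMap.id
          (show C ⊠[R] C →ₗ[R] C ⊠[R] (A ⊠[T] A) from lTensor R C s.ℓ.left)
          (assoc R R A C C (map E.ρ.coact LinearMap.id y))) := by
  induction y using BTensor.induction with
  | zero => simp
  | tmul a c =>
    rw [extend_tmul, map_rcoactT_smul, map_tmul]
    congr 1
    induction E.ρ.coact a using BTensor.induction with
    | zero => simp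
    | tmul a' c' => rfl
    | add p q hp hq => rw [BTensor.add_tmul, map_add, hp, hq, BTensor.add_tmul, map_add, map_add]
  | add p q hp hq => simp only [map_add, hp, hq]

/-- For the argument `ρ(a)` the two inputs are `(ρ ⊗ C)ρ(a)` and `(A ⊗ Δ)ρ(a)`, which agree by
coassociativity. -/
theorem map_coact_extend_coact (a : A) :
    map (E.rcoactT T) (LinearMap.id : A →ₗ[T] A) (s.extend (E.ρ.coact a))
      = map (E.lcoactT T) LinearMap.id (s.extend (E.ρ.coact a)) := by
  rw [map_rcoactT_extend, map_lcoactT_extend, E.ρ.coassoc]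

end StrongConnection

end EntwinedExtension

/-- The map `m ⊗ n ↦ m ⊗ (n ⊗ p)`, as a left linear map. -/
def BTensor.assocAuxLinear (L M : Type*) {S Q N P : Type*} [Ring L] [Ring S] [Ring Q]
    [AddCommGroup M] [Module Sᵐᵒᵖ M] [Module L M] [SMulCommClass L Sᵐᵒᵖ M] [AddCommGroup N]
    [Module S N] [Module Qᵐᵒᵖ N] [SMulCommClass S Qᵐᵒᵖ N] [AddCommGroup P] [Module Q P] (p : P) :
    M ⊠[S] N →ₗ[L] M ⊠[S] (N ⊠[Q] P) where
  toFun := assocAux p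
  map_add' := map_add _
  map_smul' l z := by
    rw [RingHom.id_apply]
    induction z using BTensor.induction with
    | zero => simp
    | tmul m n => rfl
    | add x y hx hy => rw [smul_add, map_add, map_add, hx, hy, smul_add]

namespace EntwinedExtension

/-! ### The element `a₀ ℓ(a₁)` lies in `B ⊗_T A`. -/

section SameUniverse

variable {k R A C : Type u} [CommRing k] [Ring R] [Algebra k R]
    [Ring A] [Algebra k A] [Module R A] [Module Rᵐᵒᵖ A] [IsRRing R A] [IsScalarTower k R A]
    [AddCommGroup C] [Module k C] [Module R C] [Module Rᵐᵒᵖ C] [SMulCommClass R Rᵐᵒᵖ C]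
    [IsScalarTower k R C] [IsScalarTower k Rᵐᵒᵖ C] [RCoring R C]
    {E : EntwinedExtension R A C} {T : Subalgebra k (E.coinvariants k)}

/-- The difference of the two maps, tensored with `A`, kills `a₀ ℓ(a₁)`. By flatness this element
comes from `ker ⊗_T A`, and that kernel consists of coinvariants. -/
theorem StrongConnection.extend_coact_mem_range (s : E.StrongConnection T)
    (hflat : IsFlatLeft T A) (a : A) :
    ∃ z : E.coinvariants k ⊠[T] A, inclTensor T A z = s.extend (E.ρ.coact a) := by
  have h0 : map (E.rcoactT T - E.lcoactT T) (LinearMap.id : A →ₗ[T] A)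
      (s.extend (E.ρ.coact a)) = 0 := by
    rw [map_sub_left, s.map_coact_extend_coact, sub_self]
  obtain ⟨z, hz⟩ := mem_range_ker_of_map_eq_zero hflat _ _ h0
  rw [← hz]
  generalize z = z
  clear hz
  induction z using BTensor.induction with
  | zero => exact ⟨0, by simp⟩
  | tmul b a =>
    refine ⟨tmul T (⟨b.1, E.mem_coinvariants_of_coact_eq T (sub_eq_zero.1 b.2)⟩ :
      E.coinvariants k) a, rfl⟩
  | add x y hx hy =>
    obtain ⟨x', hx⟩ := hx
    obtain ⟨y', hy⟩ := hy
    exact ⟨x' + y', by rw [map_add, map_add, hx, hy]⟩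

end SameUniverse

/-! ### The map `lower` and its compatibility with multiplication and coactions. -/

section Cotensor

variable {k R A C : Type*} [CommRing k] [Ring R] [Algebra k R]
    [Ring A] [Algebra k A] [Module R A] [Module Rᵐᵒᵖ A] [IsRRing R A] [IsScalarTower k R A]
    [AddCommGroup C] [Module k C] [Module R C] [Module Rᵐᵒᵖ C] [SMulCommClass R Rᵐᵒᵖ C]
    [IsScalarTower k R C] [IsScalarTower k Rᵐᵒᵖ C] [RCoring R C]
    {E : EntwinedExtension R A C} {T : Subalgebra k (E.coinvariants k)}
    {W : Type*} [AddCommGroup W] [Module R W] (lam : LeftComodule R C W)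

variable (T W) in
/-- The multiplication `A ⊗_T A → A`. -/
def mulT : A ⊠[T] A →+ A :=
  lift AddMonoidHom.mul (fun a t b => mul_assoc a ((t : E.coinvariants k) : A) b)

variable (T W) in
/-- The multiplication `A ⊗_T (A ⊗_R W) → A ⊗_R W`. -/
def actT : A ⊠[T] (A ⊠[R] W) →ₗ[A] A ⊠[R] W where
  toFun := lift (S := T) (smulAddHom A (A ⊠[R] W))
    (fun a t z => mul_smul a ((t : E.coinvariants k) : A) z)
  map_add' := map_add _
  map_smul' a z := by
    rw [RingHom.id_apply]
    induction z using BTensor.induction with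
    | zero => simp
    | tmul a' z => exact mul_smul a a' z
    | add x y hx hy => rw [smul_add, map_add, map_add, hx, hy, smul_add]

-- Counitality gives `a a' = a (A ⊗ ε)ρ(a')`. With `can_ℓ` it yields that the product of the legs of
-- `ℓ(c)` is `ε(c)`.
variable (T) in
theorem mulT_eq (u : A ⊠[T] A) :
    mulT T u = rid R A (map LinearMap.id (RCoring.counit (R := R) (C := C)).left (E.canT T u)) := by
  induction u using BTensor.induction with
  | zero => simp
  | tmul a b =>
    change a * b = rid R A (map LinearMap.id (RCoring.counit (R := R) (C := C)).left
      (a • E.ρ.coact b))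
    conv_lhs => rw [← E.ρ.rid_counit b]
    induction E.ρ.coact b using BTensor.induction with
    | zero => simp
    | tmul b c => exact (smul_comm a _ b)
    | add x y hx hy => rw [map_add, map_add, mul_add, hx, hy, smul_add, map_add, map_add]
  | add x y hx hy => simp only [map_add, hx, hy]

variable (T W) in
/-- The map `A ⊗_R W → A ⊗_R (C ⊗_R W)` given by the right coaction of `A`, as a left `T`-linear
map. -/
def coactTensor : A ⊠[R] W →ₗ[T] A ⊠[R] (C ⊠[R] W) where
  toFun z := assoc R R A C W (map E.ρ.coact LinearMap.id z)
  map_add' x y := by rw [map_add, map_add]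
  map_smul' t z := by
    rw [RingHom.id_apply]
    induction z using BTensor.induction with
    | zero => simp
    | tmul a w =>
      change assoc R R A C W (tmul R (E.coactT T (t • a)) w)
        = t • assoc R R A C W (tmul R (E.coactT T a) w)
      rw [map_smul]
      induction E.coactT T a using BTensor.induction with
      | zero => simp
      | tmul a' c => rfl
      | add p q hp hq => rw [smul_add, BTensor.add_tmul, map_add, hp, hq, BTensor.add_tmul,
          map_add, smul_add]
    | add x y hx hy => rw [smul_add, map_add, map_add, hx, hy, map_add, map_add, smul_add]

namespace StrongConnection

variable (s : E.StrongConnection T)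

variable (W) in
/-- The map `C ⊗_R W → A ⊗_T (A ⊗_R W)` induced by `ℓ`. -/
def tensor : C ⊠[R] W →ₗ[R] A ⊠[T] (A ⊠[R] W) where
  toFun z := assoc T R A A W (map s.ℓ.right LinearMap.id z)
  map_add' x y := by rw [map_add, map_add]
  map_smul' r z := by
    rw [RingHom.id_apply]
    induction z using BTensor.induction with
    | zero => simp
    | tmul c w =>
      change assoc T R A A W (tmul R (s.ℓ (r • c)) w) = r • assoc T R A A W (tmul R (s.ℓ c) w)
      rw [s.ℓ.apply_smul]
      induction s.ℓ c using BTensor.induction with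
      | zero => simp
      | tmul a a' => rfl
      | add p q hp hq => rw [smul_add, BTensor.add_tmul, map_add, hp, hq, BTensor.add_tmul,
          map_add, smul_add]
    | add x y hx hy => rw [smul_add, map_add, map_add, hx, hy, map_add, map_add, smul_add]

/-- The left `A`-linear map `A ⊗_R W → A ⊗_T (A ⊗_R W)` given by
`a ⊗ w ↦ a ℓ(w₍₋₁₎) ⊗ w₍₀₎`. -/
def lower : A ⊠[R] W →ₗ[A] A ⊠[T] (A ⊠[R] W) :=
  extendScalars ((s.tensor W).comp lam.coact)

theorem actT_tensor (z : C ⊠[R] W) :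
    actT T W (s.tensor W z)
      = tmul R 1 (lid R W (map (RCoring.counit (R := R) (C := C)).right LinearMap.id z)) := by
  induction z using BTensor.induction with
  | zero => simp
  | tmul c w =>
    have h : ∀ u : A ⊠[T] A, actT T W (assoc T R A A W (tmul R u w)) = tmul R (mulT T u) w := by
      intro u
      induction u using BTensor.induction with
      | zero => simp
      | tmul a b => rfl
      | add x y hx hy => rw [BTensor.add_tmul, map_add, map_add, hx, hy, map_add,
          BTensor.add_tmul]
    change actT T W (assoc T R A A W (tmul R (s.ℓ c) w)) = _
    rw [h, mulT_eq, s.can_ℓ]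
    exact BTensor.smul_tmul (1 : A) (RCoring.counit (R := R) (C := C) c) w
  | add x y hx hy => simp only [map_add, hx, hy, BTensor.tmul_add]

theorem actT_lower (z : A ⊠[R] W) : actT T W (s.lower lam z) = z := by
  induction z using BTensor.induction with
  | zero => simp
  | tmul a w =>
    change actT T W (a • s.tensor W (lam.coact w)) = _
    rw [map_smul, actT_tensor, lam.lid_counit, smul_tmul_left, smul_eq_mul, mul_one]
  | add x y hx hy => rw [map_add, map_add, hx, hy]

variable (T) in
/-- The map `A ⊗_R W → A ⊗_R (C ⊗_R W)` given by the coaction of `W`, as a left `T`-linear map. -/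
abbrev coactRight : A ⊠[R] W →ₗ[T] A ⊠[R] (C ⊠[R] W) := lTensor T A lam.coact

theorem map_coactTensor_assoc (u : A ⊠[T] A) (w : W) :
    map (LinearMap.id : A →ₗ[(↥T)ᵐᵒᵖ] A) (coactTensor T W) (assoc T R A A W (tmul R u w))
      = map (LinearMap.id : A →ₗ[(↥T)ᵐᵒᵖ] A) (assocAuxLinear T A w)
          (map LinearMap.id (E.coactT T) u) := by
  induction u using BTensor.induction with
  | zero => simp
  | tmul a a' => rfl
  | add x y hx hy => rw [BTensor.add_tmul, map_add, map_add, hx, hy, map_add, map_add]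

theorem tensor_assoc (v : C ⊠[R] C) (w : W) :
    s.tensor (C ⊠[R] W) (assoc R R C C W (tmul R v w))
      = map (LinearMap.id : A →ₗ[(↥T)ᵐᵒᵖ] A) (assocAuxLinear T A w)
          (assoc T R A A C (map s.ℓ.right LinearMap.id v)) := by
  induction v using BTensor.induction with
  | zero => simp
  | tmul c c' =>
    change assoc T R A A (C ⊠[R] W) (tmul R (s.ℓ c) (tmul R c' w))
      = map _ _ (assoc T R A A C (tmul R (s.ℓ c) c'))
    induction s.ℓ c using BTensor.induction with
    | zero => simp
    | tmul a a' => rfl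
    | add x y hx hy => rw [BTensor.add_tmul, BTensor.add_tmul, map_add, map_add, map_add, hx, hy]
  | add x y hx hy => rw [BTensor.add_tmul, map_add, map_add, hx, hy, map_add, map_add, map_add]

/-- Right colinearity trades the coaction on the second leg of `ℓ(c)` for `ℓ(c₁) ⊗ c₂`. -/
theorem map_coactTensor_tensor (z : C ⊠[R] W) :
    map (LinearMap.id : A →ₗ[(↥T)ᵐᵒᵖ] A) (coactTensor T W) (s.tensor W z)
      = s.tensor (C ⊠[R] W) (assoc R R C C W
          (map (RCoring.comul (R := R) (C := C)).right LinearMap.id z)) := by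
  induction z using BTensor.induction with
  | zero => simp
  | tmul c w =>
    refine (map_coactTensor_assoc (s.ℓ c) w).trans (Eq.trans ?_ (s.tensor_assoc _ w).symm)
    exact congrArg _ (s.right_colinear c).symm
  | add x y hx hy => simp only [map_add, hx, hy]

theorem map_coactRight_tensor (z : C ⊠[R] W) :
    map (LinearMap.id : A →ₗ[(↥T)ᵐᵒᵖ] A) (coactRight T lam) (s.tensor W z)
      = s.tensor (C ⊠[R] W) (map LinearMap.id lam.coact z) := by
  induction z using BTensor.induction with
  | zero => simp
  | tmul c w =>
    change map (LinearMap.id : A →ₗ[(↥T)ᵐᵒᵖ] A) (coactRight T lam)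
        (assoc T R A A W (tmul R (s.ℓ c) w))
      = assoc T R A A (C ⊠[R] W) (tmul R (s.ℓ c) (lam.coact w))
    induction s.ℓ c using BTensor.induction with
    | zero => simp
    | tmul a a' => rfl
    | add x y hx hy => rw [BTensor.add_tmul, map_add, map_add, hx, hy, BTensor.add_tmul, map_add]
  | add x y hx hy => simp only [map_add, hx, hy]

/-- All maps are left `A`-linear, so the claim concerns only `ℓ(w₋₁) ⊗ w₀`. There the two sides come
from `(Δ ⊗ W)` and `(C ⊗ λ)` applied to the coaction of `w`, equal by coassociativity of `W`. -/
theorem map_coact_lower (z : A ⊠[R] W) :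
    map (LinearMap.id : A →ₗ[(↥T)ᵐᵒᵖ] A) (coactTensor T W) (s.lower lam z)
      = map (LinearMap.id : A →ₗ[(↥T)ᵐᵒᵖ] A) (coactRight T lam) (s.lower lam z) := by
  induction z using BTensor.induction with
  | zero => simp
  | tmul a w =>
    change lTensor A A (coactTensor T W) (a • s.tensor W (lam.coact w))
      = lTensor A A (coactRight T lam) (a • s.tensor W (lam.coact w))
    rw [map_smul, map_smul]
    congr 1
    refine (s.map_coactTensor_tensor _).trans (Eq.trans ?_ (s.map_coactRight_tensor lam _).symm)
    rw [lam.coassoc]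
  | add x y hx hy => simp only [map_add, hx, hy]

/-- The defining equation of the cotensor product replaces `a ⊗ w₋₁ ⊗ w₀` by `a₀ ⊗ a₁ ⊗ w`, which
brings in `a₀ ℓ(a₁) ⊗ w`. -/
theorem lower_eq_of_mem_cotensor {z : A ⊠[R] W} (hz : z ∈ E.cotensor k lam) :
    s.lower lam z
      = extendScalars (s.tensor W) (assoc R R A C W (map E.ρ.coact LinearMap.id z)) := by
  have h : ∀ z : A ⊠[R] W,
      s.lower lam z = extendScalars (s.tensor W) (map LinearMap.id lam.coact z) := by
    intro z
    induction z using BTensor.induction with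
    | zero => simp
    | tmul a w => rfl
    | add x y hx hy => simp only [map_add, hx, hy]
  rw [h]
  exact congrArg _ (Eq.symm hz)

theorem extendScalars_tensor_assoc (y : A ⊠[R] C) (w : W) :
    extendScalars (s.tensor W) (assoc R R A C W (tmul R y w))
      = assoc T R A A W (tmul R (s.extend y) w) := by
  induction y using BTensor.induction with
  | zero => simp
  | tmul a c =>
    change a • assoc T R A A W (tmul R (s.ℓ c) w) = _
    rw [← assoc_smul]
    rfl
  | add x y hx hy => rw [BTensor.add_tmul, map_add, map_add, hx, hy, map_add, BTensor.add_tmul,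
      map_add]

end StrongConnection

end Cotensor

/-! ### The section on the cotensor product and relative projectivity. -/

section Main

variable {k R A C : Type u} [CommRing k] [Ring R] [Algebra k R]
    [Ring A] [Algebra k A] [Module R A] [Module Rᵐᵒᵖ A] [IsRRing R A] [IsScalarTower k R A]
    [AddCommGroup C] [Module k C] [Module R C] [Module Rᵐᵒᵖ C] [SMulCommClass R Rᵐᵒᵖ C]
    [IsScalarTower k R C] [IsScalarTower k Rᵐᵒᵖ C] [RCoring R C]
    {E : EntwinedExtension R A C} {T : Subalgebra k (E.coinvariants k)}
    {W : Type u} [AddCommGroup W] [Module R W] (lam : LeftComodule R C W)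

namespace StrongConnection

variable (s : E.StrongConnection T)

theorem exists_inclTensor_eq_extendScalars (hflat : IsFlatLeft T A) (z : A ⊠[R] W) :
    ∃ y : E.coinvariants k ⊠[T] (A ⊠[R] W), inclTensor T (A ⊠[R] W) y
      = extendScalars (s.tensor W) (assoc R R A C W (map E.ρ.coact LinearMap.id z)) := by
  induction z using BTensor.induction with
  | zero => exact ⟨0, by simp⟩
  | tmul a w =>
    obtain ⟨y, hy⟩ := s.extend_coact_mem_range hflat a
    refine ⟨assoc T R (E.coinvariants k) A W (tmul R y w), ?_⟩
    refine Eq.trans ?_ (s.extendScalars_tensor_assoc (E.ρ.coact a) w).symm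
    rw [← hy]
    clear hy
    induction y using BTensor.induction with
    | zero => simp
    | tmul b a' => rfl
    | add x y hx hy => rw [BTensor.add_tmul, map_add, map_add, hx, hy, map_add, BTensor.add_tmul,
        map_add]
  | add x y hx hy =>
    obtain ⟨x', hx⟩ := hx
    obtain ⟨y', hy⟩ := hy
    exact ⟨x' + y', by rw [map_add, map_add, map_add, map_add, hx, hy]⟩

end StrongConnection

variable (T) in
/-- The inclusion of the cotensor product into `A ⊗_R W`, as a left `T`-linear map. -/
def cotensorIncl : E.cotensor k lam →ₗ[T] A ⊠[R] W where
  toFun z := z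
  map_add' _ _ := rfl
  map_smul' _ _ := rfl

variable (T) in
theorem exact_cotensorIncl :
    Function.Exact (cotensorIncl T lam)
      (coactTensor T W - StrongConnection.coactRight T lam) := by
  intro z
  rw [LinearMap.sub_apply, sub_eq_zero]
  exact ⟨fun h => ⟨⟨z, h⟩, rfl⟩, fun ⟨y, hy⟩ => hy ▸ y.2⟩

variable (T) in
theorem cotensorIncl_injective : Function.Injective (cotensorIncl T lam) :=
  Subtype.val_injective

namespace StrongConnection

variable (s : E.StrongConnection T)

theorem map_sub_lower (z : A ⊠[R] W) :
    map (LinearMap.id : A →ₗ[(↥T)ᵐᵒᵖ] A) (coactTensor T W - coactRight T lam)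
      (s.lower lam z) = 0 := by
  rw [map_sub_right, s.map_coact_lower, sub_self]

/-- This holds on all of `A ⊗_R W`, not only on `Γ`; finite generation applies it to `1 ⊗ w`. -/
theorem exists_map_eq_lower (hproj : Module.Projective (↥T)ᵐᵒᵖ A) (z : A ⊠[R] W) :
    ∃ y : A ⊠[T] E.cotensor k lam,
      map (LinearMap.id : A →ₗ[(↥T)ᵐᵒᵖ] A) (cotensorIncl T lam) y = s.lower lam z :=
  (exact_map_of_projective (M := A) (cotensorIncl T lam) (coactTensor T W - coactRight T lam)
    (exact_cotensorIncl T lam) (s.lower lam z)).1 (s.map_sub_lower lam z)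

variable (T) in
/-- The map `B ⊗_T Γ → A ⊗_T (A ⊗_R W)` for the cotensor product `Γ`. -/
def _root_.EntwinedExtension.cotensorEmb :
    E.coinvariants k ⊠[T] E.cotensor k lam →ₗ[E.coinvariants k] A ⊠[T] (A ⊠[R] W) :=
  (inclTensor T (A ⊠[R] W)).comp (lTensor (E.coinvariants k) (E.coinvariants k)
    (cotensorIncl T lam))

/-- The value has a preimage `y` in `B ⊗_T (A ⊗_R W)`. The difference of coactions kills `y`,
because it does so inside `A ⊗_T (A ⊗_R (C ⊗_R W))`, where `B ⊗_T` embeds. Exactness of `B ⊗_T -`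
then moves `y` into `B ⊗_T Γ`. -/
theorem exists_cotensorEmb_eq_lower (hproj : Module.Projective (↥T)ᵐᵒᵖ A)
    (hflat : IsFlatLeft T A) (hff : IsFaithfullyFlatRight (E.coinvariants k) A)
    (z : E.cotensor k lam) : ∃ y, cotensorEmb T lam y = s.lower lam (z : A ⊠[R] W) := by
  obtain ⟨y, hy⟩ := s.exists_inclTensor_eq_extendScalars hflat (z : A ⊠[R] W)
  rw [← s.lower_eq_of_mem_cotensor lam z.2] at hy
  have h : map (LinearMap.id : E.coinvariants k →ₗ[(↥T)ᵐᵒᵖ] E.coinvariants k)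
      (coactTensor T W - coactRight T lam) y = 0 := by
    apply inclTensor_injective T (A ⊠[R] (C ⊠[R] W)) hff
    rw [map_zero, ← s.map_sub_lower lam z, ← hy]
    generalize y = y
    induction y using BTensor.induction with
    | zero => simp
    | tmul b x => rfl
    | add x y hx hy => rw [map_add, map_add, hx, hy, map_add, map_add]
  obtain ⟨y', hy'⟩ := (exact_map_of_faithfullyFlat T hff _ _ (exact_cotensorIncl T lam) y).1 h
  exact ⟨y', by rw [← hy, ← hy']; rfl⟩

theorem _root_.EntwinedExtension.cotensorEmb_eq
    (y : E.coinvariants k ⊠[T] E.cotensor k lam) :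
    cotensorEmb T lam y
      = map (LinearMap.id : A →ₗ[(↥T)ᵐᵒᵖ] A) (cotensorIncl T lam) (inclTensor T _ y) := by
  induction y using BTensor.induction with
  | zero => simp
  | tmul b x => rfl
  | add x y hx hy => rw [map_add, map_add, hx, hy, map_add]

-- The embedding also factors through `A ⊗_T Γ`. Along that route the first map is injective by
-- faithful flatness and the second by projectivity of `A`.
variable (T) in
theorem _root_.EntwinedExtension.cotensorEmb_injective (hproj : Module.Projective (↥T)ᵐᵒᵖ A)
    (hff : IsFaithfullyFlatRight (E.coinvariants k) A) :
    Function.Injective (cotensorEmb T lam) := by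
  intro x y hxy
  rw [cotensorEmb_eq, cotensorEmb_eq] at hxy
  exact inclTensor_injective T _ hff
    (map_id_injective_of_projective (M := A) (cotensorIncl T lam)
      (cotensorIncl_injective T lam) hxy)

theorem _root_.EntwinedExtension.coe_relMul (y : E.coinvariants k ⊠[T] E.cotensor k lam) :
    (relMul T (E.cotensor k lam) y : A ⊠[R] W) = actT T W (cotensorEmb T lam y) := by
  induction y using BTensor.induction with
  | zero => simp
  | tmul b x => rfl
  | add x y hx hy => rw [map_add, map_add, map_add, ← hx, ← hy]; rfl

theorem isRelProjective (s : E.StrongConnection T) (hproj : Module.Projective (↥T)ᵐᵒᵖ A)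
    (hflat : IsFlatLeft T A) (hff : IsFaithfullyFlatRight (E.coinvariants k) A) :
    IsRelProjective T (E.cotensor k lam) := by
  -- Injectivity of `cotensorEmb` makes the chosen preimages unique, so `σ` inherits `B`-linearity
  -- from `lower`.
  choose σ hσ using s.exists_cotensorEmb_eq_lower lam hproj hflat hff
  have hinj := cotensorEmb_injective T lam hproj hff
  refine ⟨{ toFun := σ, map_add' := fun x y => hinj ?_, map_smul' := fun b x => hinj ?_ },
    fun m => Subtype.ext ?_⟩
  · rw [map_add, hσ, hσ, hσ, ← map_add]
    rfl
  · rw [RingHom.id_apply, map_smul, hσ, hσ]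
    exact (s.lower lam).map_smul (b : A) (x : A ⊠[R] W)
  · rw [coe_relMul]
    exact (congrArg (actT T W) (hσ m)).trans (s.actT_lower lam _)

end StrongConnection

end Main

end EntwinedExtension

/-! ### Finite generation of the cotensor product by faithfully flat descent. -/

theorem BTensor.exists_finset_mem_closure {S M N : Type*} [Ring S] [AddCommGroup M]
    [Module Sᵐᵒᵖ M] [AddCommGroup N] [Module S N] (z : M ⊠[S] N) :
    ∃ F : Finset N, z ∈ AddSubgroup.closure {y | ∃ m, ∃ n ∈ F, y = tmul S m n} := by
  classical
  induction z using BTensor.induction with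
  | zero => exact ⟨∅, zero_mem _⟩
  | tmul m n => exact ⟨{n}, AddSubgroup.subset_closure ⟨m, n, by simp, rfl⟩⟩
  | add x y hx hy =>
    obtain ⟨F, hF⟩ := hx
    obtain ⟨F', hF'⟩ := hy
    refine ⟨F ∪ F', add_mem (AddSubgroup.closure_mono ?_ hF) (AddSubgroup.closure_mono ?_ hF')⟩
    · rintro _ ⟨m, n, hn, rfl⟩
      exact ⟨m, n, by simp [hn], rfl⟩
    · rintro _ ⟨m, n, hn, rfl⟩
      exact ⟨m, n, by simp [hn], rfl⟩

section Subalgebra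

variable {k A : Type u} [CommRing k] [Ring A] [Algebra k A] {B : Subalgebra k A}
  (T : Subalgebra k B) (N : Type u) [AddCommGroup N] [Module B N]

/-- The canonical map `A ⊗_T N → A ⊗_B N`. -/
def BTensor.toLarger : A ⊠[T] N →ₗ[A] A ⊠[B] N where
  toFun := lift (S := T) (mk B A N) (fun a t n => BTensor.smul_tmul a (t : B) n)
  map_add' := map_add _
  map_smul' a z := by
    rw [RingHom.id_apply]
    induction z using BTensor.induction with
    | zero => simp
    | tmul a' n => rfl
    | add x y hx hy => rw [smul_add, map_add, map_add, hx, hy, smul_add]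

/-- Over `B` the scalar `b` moves across the tensor sign. For a section value of `γ` under `relMul`,
this makes the image in `A ⊗_B Γ` equal to `1 ⊗ γ`. -/
theorem BTensor.toLarger_inclTensor (z : B ⊠[T] N) :
    toLarger T N (inclTensor T N z) = tmul B (1 : A) (relMul T N z) := by
  induction z using BTensor.induction with
  | zero => simp
  | tmul b n =>
    change tmul B (b : A) n = tmul B (1 : A) (b • n)
    rw [← BTensor.smul_tmul (1 : A) b n]
    exact congrArg (fun a => tmul B a n) (one_mul (b : A)).symm
  | add x y hx hy => rw [map_add, map_add, hx, hy, map_add, BTensor.tmul_add]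

end Subalgebra

theorem IsRRing.tmul_mem_of_span {R A W : Type*} [Ring R] [Ring A] [Module R A] [Module Rᵐᵒᵖ A]
    [IsRRing R A] [AddCommGroup W] [Module R W] {S : Set W} (hS : Submodule.span R S = ⊤)
    (P : Submodule A (A ⊠[R] W)) (h : ∀ w ∈ S, tmul R 1 w ∈ P) : P = ⊤ := by
  have h1 : ∀ w : W, tmul R 1 w ∈ P := by
    intro w
    have hw : w ∈ Submodule.span R S := hS ▸ Submodule.mem_top
    induction hw using Submodule.span_induction with
    | mem w hw => exact h w hw
    | zero => rw [BTensor.tmul_zero]; exact zero_mem P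
    | add x y _ _ hx hy => rw [BTensor.tmul_add]; exact add_mem hx hy
    | smul r w _ hw =>
      have := P.smul_mem (op r • (1 : A)) hw
      rwa [smul_tmul_left, smul_eq_mul, mul_one, BTensor.smul_tmul] at this
  rw [eq_top_iff]
  rintro z -
  induction z using BTensor.induction with
  | zero => exact zero_mem P
  | tmul a w =>
    have := P.smul_mem a (h1 w)
    rwa [smul_tmul_left, smul_eq_mul, mul_one] at this
  | add x y hx hy => exact add_mem hx hy

namespace EntwinedExtension

variable {k R A C : Type u} [CommRing k] [Ring R] [Algebra k R]
    [Ring A] [Algebra k A] [Module R A] [Module Rᵐᵒᵖ A] [IsRRing R A] [IsScalarTower k R A]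
    [AddCommGroup C] [Module k C] [Module R C] [Module Rᵐᵒᵖ C] [SMulCommClass R Rᵐᵒᵖ C]
    [IsScalarTower k R C] [IsScalarTower k Rᵐᵒᵖ C] [RCoring R C]
    {E : EntwinedExtension R A C} {T : Subalgebra k (E.coinvariants k)}
    {W : Type u} [AddCommGroup W] [Module R W] (lam : LeftComodule R C W)

namespace StrongConnection

theorem finite_cotensor (s : E.StrongConnection T) (hproj : Module.Projective (↥T)ᵐᵒᵖ A)
    (hflat : IsFlatLeft T A) (hff : IsFaithfullyFlatRight (E.coinvariants k) A)
    (hW : Module.Finite R W) : Module.Finite (E.coinvariants k) (E.cotensor k lam) := by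
  classical
  obtain ⟨S, hS⟩ := hW.fg_top
  -- `τ w` lifts `lower (1 ⊗ w)` to `A ⊗_T Γ`, and `F w` collects right legs sufficient to express
  -- it. Only the generators `w ∈ S` contribute to `G`.
  choose τ hτ using fun w : W => s.exists_map_eq_lower lam hproj (tmul R (1 : A) w)
  choose F hF using fun w : W => BTensor.exists_finset_mem_closure (τ w)
  let G : Submodule (E.coinvariants k) (E.cotensor k lam) :=
    Submodule.span _ (S.biUnion F : Set (E.cotensor k lam))
  let H : Submodule A (A ⊠[E.coinvariants k] E.cotensor k lam) :=
    LinearMap.range (lTensor A A G.subtype)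
  let q := toLarger T (E.cotensor k lam)
  let ι := lTensor A A (cotensorIncl T lam)
  have hι : Function.Injective ι :=
    map_id_injective_of_projective (M := A) (cotensorIncl T lam) (cotensorIncl_injective T lam)
  have hτH : ∀ w ∈ S, q (τ w) ∈ H := by
    intro w hw
    refine (AddSubgroup.closure_le (K := H.toAddSubgroup.comap q.toAddMonoidHom)).2 ?_ (hF w)
    rintro _ ⟨a, γ, hγ, rfl⟩
    exact ⟨tmul _ a ⟨γ, Submodule.subset_span (by simpa using ⟨w, hw, hγ⟩)⟩, rfl⟩
  -- The left side is an `A`-submodule of `A ⊗_R W`, so containing `1 ⊗ w` for the generators `w`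
  -- forces it to be everything.
  have hP : ((H.comap q).map ι).comap (s.lower lam) = ⊤ :=
    IsRRing.tmul_mem_of_span hS _ fun w hw => ⟨τ w, hτH w hw, hτ w⟩
  have h1 : ∀ γ : E.cotensor k lam, tmul (E.coinvariants k) (1 : A) γ ∈ H := by
    intro γ
    obtain ⟨y, hy⟩ := s.exists_cotensorEmb_eq_lower lam hproj hflat hff γ
    have hγ : (γ : A ⊠[R] W) ∈ ((H.comap q).map ι).comap (s.lower lam) := hP ▸ Submodule.mem_top
    obtain ⟨z, hz, hz'⟩ := hγ
    -- Two lifts of `lower γ` to `A ⊗_T Γ` coincide: `z`, whose image in `A ⊗_B Γ` lies in `H`, and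
    -- the one coming from `B ⊗_T Γ`, whose image is `1 ⊗ γ`.
    have hzy : z = inclTensor T _ y := hι (by
      rw [hz', ← hy, cotensorEmb_eq]
      rfl)
    have hm : relMul T (E.cotensor k lam) y = γ := Subtype.ext (by
      rw [coe_relMul, hy, s.actT_lower])
    have := toLarger_inclTensor T (E.cotensor k lam) y
    rw [hm, ← hzy] at this
    rw [← this]
    exact hz
  have hsurj : Function.Surjective G.subtype := by
    refine surjective_of_faithfullyFlat hff _ fun z => ?_
    change z ∈ H
    induction z using BTensor.induction with
    | zero => exact zero_mem H
    | tmul a γ =>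
      have := H.smul_mem a (h1 γ)
      rwa [smul_tmul_left, smul_eq_mul, mul_one] at this
    | add x y hx hy => exact add_mem hx hy
  refine ⟨⟨S.biUnion F, ?_⟩⟩
  rw [eq_top_iff]
  rintro γ -
  obtain ⟨g, rfl⟩ := hsurj γ
  exact g.2

end StrongConnection

end EntwinedExtension

end

theorem theorem5 {k R A C : Type u} [CommRing k] [Ring R] [Algebra k R]
    [Ring A] [Algebra k A] [Module R A] [Module Rᵐᵒᵖ A] [IsRRing R A] [IsScalarTower k R A]
    [AddCommGroup C] [Module k C] [Module R C] [Module Rᵐᵒᵖ C] [SMulCommClass R Rᵐᵒᵖ C]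
    [IsScalarTower k R C] [IsScalarTower k Rᵐᵒᵖ C] [RCoring R C]
    (E : EntwinedExtension R A C) (T : Subalgebra k (E.coinvariants k))
    (hproj : Module.Projective (↥T)ᵐᵒᵖ A) (hflat : IsFlatLeft T A)
    (hff : IsFaithfullyFlatRight (E.coinvariants k) A)
    (hconn : Nonempty (E.StrongConnection T))
    {W : Type u} [AddCommGroup W] [Module R W] (lam : LeftComodule R C W)
    (hW : Module.Finite R W) :
    Module.Finite (E.coinvariants k) (E.cotensor k lam) ∧
      IsRelProjective T (E.cotensor k lam) := by
  obtain ⟨s⟩ := hconn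
  exact ⟨s.finite_cotensor lam hproj hflat hff hW, s.isRelProjective lam hproj hflat hff⟩
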